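/- **Setting.** Let $D>3$. In Gate Model I (fan-in at most $D$) every activation of a gate outputs the correct value XORed with an independent noise bit; AND, XOR and majority gates fail with probabilities $p_{\text{and}},p_{\text{xor}},p_{\text{maj}}\ge 0$. A majority gate outputs the strict majority of its inputs and, on a tie, an independent fair random bit. Let $\mathbf A$ be an $L\times K$ binary matrix, $L\ge 2$, $K\ge 1$. Take a $(d_v,d_c)$-regular LDPC code of length $N$ and dimension $K$ with systematic generator matrix $\mathbf G=[\mathbf I,\mathbf P]$ such that - (A.1) $4\le d_v\le D$ and $4\le d_c\le D$; - (A.2) the girth of the Tanner graph satisfies $l_g>\frac{2\log N}{\log((d_v-1)(d_c-1))}-2c_g$ with $c_g=1-\frac{\log\frac{d_cd_v-d_c-d_v}{2d_c}}{\log((d_v-1)(d_c-1))}$. Let $E=d_vN$ be the number of edges of the Tanner graph, and let $2\le d_T\le D$. ENCODED-T computes $\mathbf s\mathbf A\mathbf G$ over $\mathbb F_2$, and thereby $\mathbf r=\mathbf s\mathbf A$, along a $d_T$-branch tree with $L$ leaves, which is full except possibly at the bottom level, and has $\lceil (L-1)/(d_T-1)\rceil$ non-leaf nodes. Each node keeps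 one bit per Tanner graph edge (so $d_v$ copies of each codeword bit). The $l$-th leaf multiplies $s_l$ with the $l$-th row of $\mathbf A\mathbf G$, using one AND gate per edge. Each non-leaf node XORs the vectors of its at most $d_T$ children edge by edge, and then performs one iteration of Gallager-B decoding: on each edge $(v,c)$, one XOR gate computes the message $c\to v$ from the bits on the other edges at $c$, and then one majority gate computes the new bit $v\to c$ from the messages on the other edges at $v$. The $k$-th output bit is a uniformly chosen one of the $d_v$ copies, at the root, of the $k$-th codeword bit. Its bit error probability is $P_e^{\text{bit}}=\frac1K\sum_{k=1}^K\Pr(\hat r_k\ne r_k)$, where the input $\mathbf s$ is uniform and independent of the noise. $\mathscr N_{\text{per-bit}}$ is the number of gate activations divided by $K$. **Theorem.** Put $d=\lceil\frac{d_v-1}{2}\rceil$ and $$p_{\text{thr}}=\binom{d_v-1}{\lfloor\frac{d_v-1}{2}\rfloor}^{-\frac1{d-1}}d_c^{-\frac d{d-1}}\,d_T^{-\frac1{d-1}}\,(d_T+1)^{-\frac d{d-1}}.$$ Suppose that $$p_{\text{maj}}\le p_{\text{thr}},\quad p_{\text{xor}}\le\frac{d_T+1}{d_c}p_{\text{thr}},\quad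 p_{\text{and}}\le\frac{d_T+1}{d_T}p_{\text{thr}},\quad \left\lceil\frac{\log L}{\log d_T}\right\rceil\le\frac{\log N}{2\log((d_v-1)(d_c-1))}.$$ Then ENCODED-T only uses gates with at most $D$ inputs, its output bit error probability satisfies $$P_e^{\text{bit}}\le p_{\text{maj}}+\frac{1}{d_T}p_{\text{thr}},$$ and $$\mathscr N_{\text{per-bit}}\le\frac{3E}{K}\left\lceil\frac{L-1}{d_T-1}\right\rceil+\frac{LE}{K}=\Theta\!\left(\frac{LN}{K}\right).$$ Moreover $\mathscr N_{\text{per-bit}}$ itself is $\Theta(LN/K)$. Both $\Theta$'s hold with positive constants that depend only on $D$. -/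

import Mathlib

noncomputable section

namespace Encoded

/-! ### Unreliable gates and noisy computations -/

/-- The three kinds of gates. -/
inductive GateKind : Type
  | and
  | xor
  | maj

/-- Majority of a multiset of `n` bits: the value `x` if at least `⌊n / 2⌋ + 1` of the bits equal
`x`, and the random bit `z` if there is no such `x` (a tie). For `n = d - 1` the threshold
`⌊n / 2⌋ + 1` is `⌊(d + 1) / 2⌋`. -/
def majority (z : ZMod 2) (u : Multiset (ZMod 2)) : ZMod 2 :=
  if u.card / 2 + 1 ≤ u.count 0 then 0
  else if u.card / 2 + 1 ≤ u.count 1 then 1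
  else z

/-- The boolean function computed by a gate that does not fail. The functions are symmetric, so
that the inputs form a multiset; the tie-breaking bit `z` is used by majority gates only. -/
def GateKind.eval : GateKind → ZMod 2 → Multiset (ZMod 2) → ZMod 2
  | .and, _, u => u.prod
  | .xor, _, u => u.sum
  | .maj, z, u => majority z u

/-- What an input wire of a gate can be attached to: a bit of the input vector, a bit stored
offline, or the register that keeps the outcome of an earlier operation. -/
inductive Source (L : ℕ) (Op : Type) : Type
  | input (l : Fin L)
  | const (b : ZMod 2)
  | reg (o : Op)

/-- The bit carried by a wire, given the input vector and the contents of the registers. -/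
def Source.read {L : ℕ} {Op : Type} (s : Fin L → ZMod 2) (mem : Op → ZMod 2) :
    Source L Op → ZMod 2
  | .input l => s l
  | .const b => b
  | .reg o => mem o

/-- A computing scheme with `L` input bits and `K` output bits that runs on a noisy circuit in a
predetermined number of stages (time slots). An element of `Op` is an *operation*, that is, one
activation of one unreliable gate in one stage; its outcome is written to an error-free register.
A gate only reads registers written in earlier stages. The `k`-th output bit is read from a
register that is chosen uniformly at random from the set `output k`. -/
structure Scheme (L K : ℕ) where
  Op : Type
  fintypeOp : Fintype Op
  stages : ℕ
  stage : Op → Fin stages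
  kind : Op → GateKind
  inputs : Op → Multiset (Source L Op)
  feasible : ∀ o o', Source.reg o' ∈ inputs o → stage o' < stage o
  output : Fin K → Finset Op
  output_nonempty : ∀ k, (output k).Nonempty

namespace Scheme

variable {L K : ℕ} (C : Scheme L K)

instance instFintypeOp : Fintype C.Op := C.fintypeOp

instance instMeasurableSpaceOp : MeasurableSpace C.Op := ⊤

/-- Contents of the registers after the first `t` stages, for the input `s`, the gate failures
`z` (`z o = 1` means that the gate fails, and flips its output, in operation `o`) and the
tie-breaking bits `c`. -/
def memory (s : Fin L → ZMod 2) (z c : C.Op → ZMod 2) : ℕ → C.Op → ZMod 2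
  | 0 => fun _ => 0
  | t + 1 => fun o =>
      if (C.stage o : ℕ) = t then
        (C.kind o).eval (c o) ((C.inputs o).map (Source.read s (memory s z c t))) + z o
      else memory s z c t o

/-- The sample space: input vector, gate failures, tie-breaking bits, choice of the registers from
which the outputs are read. -/
abbrev Sample : Type :=
  (Fin L → ZMod 2) × (C.Op → ZMod 2) × (C.Op → ZMod 2) × (Fin K → C.Op)

/-- The (random) output vector of the scheme. -/
def result (ω : C.Sample) (k : Fin K) : ZMod 2 :=
  C.memory ω.1 ω.2.1 ω.2.2.1 C.stages (ω.2.2.2 k)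

end Scheme

/-- The law of a bit that is `1` with probability `p`. -/
def bitLaw (p : ℝ) : MeasureTheory.Measure (ZMod 2) :=
  ENNReal.ofReal (1 - p) • MeasureTheory.Measure.dirac 0 +
    ENNReal.ofReal p • MeasureTheory.Measure.dirac 1

namespace Scheme

variable {L K : ℕ} (C : Scheme L K)

/-- The joint law under Gate Model I: the input is uniformly distributed, an operation performed
by a gate of kind `g` fails with probability `ε g`, the tie-breaking bits are fair, the registers
of the outputs are chosen uniformly, and all of these are independent. -/
def law (ε : GateKind → ℝ) : MeasureTheory.Measure C.Sample :=
  (ProbabilityTheory.uniformOn (Set.univ : Set (Fin L → ZMod 2))).prod <|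
    (MeasureTheory.Measure.pi fun o => bitLaw (ε (C.kind o))).prod <|
      (MeasureTheory.Measure.pi fun _ => bitLaw (1 / 2)).prod <|
        MeasureTheory.Measure.pi fun k =>
          ProbabilityTheory.uniformOn (C.output k : Set C.Op)

/-- The bit error probability of the scheme as a way to compute `r = s A`: the average over the
output bits of the probability that the output bit is wrong. -/
def bitErrorProb (A : Matrix (Fin L) (Fin K) (ZMod 2)) (ε : GateKind → ℝ) : ℝ :=
  1 / (K : ℝ) *
    ∑ k : Fin K, (C.law ε).real {ω | C.result ω k ≠ Matrix.vecMul ω.1 A k}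

/-- The total number of unreliable operations: the sum over the stages of the number of gates
activated in that stage. -/
def opCount : ℕ :=
  ∑ t : Fin C.stages, Nat.card {o : C.Op // C.stage o = t}

/-- The number of operations per output bit. -/
def opsPerBit : ℝ :=
  (C.opCount : ℝ) / (K : ℝ)

/-- Every gate has at most `D` inputs; the tie-breaking bit is counted as an input of a majority
gate. -/
def FanInLE (D : ℕ) : Prop :=
  ∀ o, match C.kind o with
    | .maj => (C.inputs o).card + 1 ≤ D
    | _ => (C.inputs o).card ≤ D

end Scheme

/-! ### Regular LDPC codes -/

/-- A `(dv, dc)`-regular LDPC code of length `N` and dimension `K`, given by a parity check matrix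
`H` and a systematic generator matrix `G = [I, P]`. -/
structure LDPC (N K dv dc : ℕ) where
  numChecks : ℕ
  H : Matrix (Fin numChecks) (Fin N) (ZMod 2)
  G : Matrix (Fin K) (Fin N) (ZMod 2)
  var_degree : ∀ v, (Finset.univ.filter fun c => H c v ≠ 0).card = dv
  check_degree : ∀ c, (Finset.univ.filter fun v => H c v ≠ 0).card = dc
  dim_le : K ≤ N
  systematic : ∀ i j, G i (Fin.castLE dim_le j) = if i = j then 1 else 0
  span_rows : Submodule.span (ZMod 2) (Set.range G.row) = LinearMap.ker H.mulVecLin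

namespace LDPC

variable {N K dv dc : ℕ} (Q : LDPC N K dv dc)

/-- The Tanner graph, on the parity check nodes and the variable nodes. -/
def tannerGraph : SimpleGraph (Fin Q.numChecks ⊕ Fin N) :=
  SimpleGraph.fromRel fun a b => ∃ c v, a = Sum.inl c ∧ b = Sum.inr v ∧ Q.H c v ≠ 0

/-- The edges of the Tanner graph, as pairs of a parity check node and a variable node. -/
abbrev Edge : Type :=
  {e : Fin Q.numChecks × Fin N // Q.H e.1 e.2 ≠ 0}

/-- The other edges at the parity check node of `e`. -/
def checkNbrs (e : Q.Edge) : Finset Q.Edge :=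
  Finset.univ.filter fun e' => e'.1.1 = e.1.1 ∧ e' ≠ e

/-- The other edges at the variable node of `e`. -/
def varNbrs (e : Q.Edge) : Finset Q.Edge :=
  Finset.univ.filter fun e' => e'.1.2 = e.1.2 ∧ e' ≠ e

/-- The large girth condition
`girth > 2 log N / log ((dv - 1) (dc - 1)) - 2 c`, where
`c = 1 - log ((dc dv - dc - dv) / (2 dc)) / log ((dv - 1) (dc - 1))`. -/
def LargeGirth : Prop :=
  (Q.tannerGraph.girth : ℝ) >
    2 * Real.log N / Real.log (((dv : ℝ) - 1) * ((dc : ℝ) - 1)) -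
      2 * (1 - Real.log (((dc : ℝ) * dv - dc - dv) / (2 * dc)) /
        Real.log (((dv : ℝ) - 1) * ((dc : ℝ) - 1)))

end LDPC

/-! ### The scheme ENCODED-T -/

section Tree

/-- The number `⌈(L - 1) / (dT - 1)⌉` of non-leaf nodes of the computation tree. -/
def numInternal (L dT : ℕ) : ℕ := ⌈((L : ℚ) - 1) / ((dT : ℚ) - 1)⌉₊

/-- The nodes of the `dT`-branch computation tree with `L` leaves: the non-leaf nodes and the
leaves. -/
abbrev Node (L dT : ℕ) : Type := Fin (numInternal L dT) ⊕ Fin L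

/-- The position of a node when the nodes are listed level by level, starting from the root; all
levels but the bottom one are full, and the leaves come last in this list. -/
def Node.index {L dT : ℕ} : Node L dT → ℕ
  | .inl u => u
  | .inr l => numInternal L dT + l

/-- The children of a non-leaf node. -/
def children {L dT : ℕ} (u : Fin (numInternal L dT)) : Finset (Node L dT) :=
  Finset.univ.filter fun w => Node.index w ∈ Finset.Icc (dT * u + 1) (dT * u + dT)

/-- The level (the root has level `0`) of the `n`-th node of a `dT`-branch tree listed level by
level: level `m` starts at position `(dT ^ m - 1) / (dT - 1)`. -/
def level (dT n : ℕ) : ℕ := Nat.log dT ((dT - 1) * n + 1)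

/-- The bottommost level that contains a non-leaf node. -/
def lastLevel (L dT : ℕ) : ℕ := level dT (numInternal L dT - 1)

theorem level_child {dT u w : ℕ} (hT : 2 ≤ dT) (h : dT * u + 1 ≤ w) :
    level dT u + 1 ≤ level dT w := by
  unfold level
  rw [← Nat.log_mul_base (by omega) (by omega)]
  apply Nat.log_mono_right
  obtain ⟨k, rfl⟩ : ∃ k, dT = k + 1 := ⟨dT - 1, by omega⟩
  simp only [Nat.add_sub_cancel]
  nlinarith [Nat.mul_le_mul_left k h]

theorem level_le_lastLevel {L dT : ℕ} (u : Fin (numInternal L dT)) :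
    level dT u ≤ lastLevel L dT := by
  unfold lastLevel level
  apply Nat.log_mono_right
  have := u.2
  have h : (u : ℕ) ≤ numInternal L dT - 1 := by omega
  have := Nat.mul_le_mul_left (dT - 1) h
  omega

theorem numInternal_pos {L dT : ℕ} (hL : 2 ≤ L) (hT : 2 ≤ dT) : 0 < numInternal L dT := by
  unfold numInternal
  rw [Nat.ceil_pos]
  have h1 : (2 : ℚ) ≤ L := by exact_mod_cast hL
  have h2 : (2 : ℚ) ≤ dT := by exact_mod_cast hT
  apply div_pos <;> linarith

end Tree

/-- The operations of ENCODED-T. Every node of the tree keeps one bit for each edge of the Tanner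
graph. In a leaf this bit is computed by an AND gate (`leaf`). In a non-leaf node, an XOR gate adds
the bits of the children (`add`); then follows one Gallager-B iteration, with an XOR gate for the
message from the check node to the variable node (`check`) and a majority gate for the message
from the variable node to the check node (`vote`). -/
inductive TOp (L S : ℕ) (E : Type) : Type
  | leaf (l : Fin L) (e : E)
  | add (u : Fin S) (e : E)
  | check (u : Fin S) (e : E)
  | vote (u : Fin S) (e : E)

/-- The operations as a disjoint union. -/
def TOp.equiv (L S : ℕ) (E : Type) :
    ((Fin L × E) ⊕ (Fin S × E)) ⊕ ((Fin S × E) ⊕ (Fin S × E)) ≃ TOp L S E where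
  toFun
    | .inl (.inl (l, e)) => .leaf l e
    | .inl (.inr (u, e)) => .add u e
    | .inr (.inl (u, e)) => .check u e
    | .inr (.inr (u, e)) => .vote u e
  invFun
    | .leaf l e => .inl (.inl (l, e))
    | .add u e => .inl (.inr (u, e))
    | .check u e => .inr (.inl (u, e))
    | .vote u e => .inr (.inr (u, e))
  left_inv := by rintro ((⟨_, _⟩ | ⟨_, _⟩) | (⟨_, _⟩ | ⟨_, _⟩)) <;> rfl
  right_inv := by rintro (_ | _ | _ | _) <;> rfl

instance TOp.instFintype (L S : ℕ) (E : Type) [Fintype E] : Fintype (TOp L S E) :=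
  Fintype.ofEquiv _ (TOp.equiv L S E)

/-- The operation whose outcome is the bit that a node of the tree keeps for the edge `e` and
passes to its parent. -/
def nodeOut {L dT : ℕ} {E : Type} (e : E) : Node L dT → TOp L (numInternal L dT) E
  | .inl u => .vote u e
  | .inr l => .leaf l e

section EncodedT

variable {L K N dv dc : ℕ}

/-- The wiring of ENCODED-T for `r = s A`: the `l`-th leaf multiplies `s l` with the `l`-th row of
`A G`, once for each edge. -/
def encodedTInputs (dT : ℕ) (A : Matrix (Fin L) (Fin K) (ZMod 2)) (Q : LDPC N K dv dc) :
    TOp L (numInternal L dT) Q.Edge → Multiset (Source L (TOp L (numInternal L dT) Q.Edge))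
  | .leaf l e => {Source.input l, Source.const ((A * Q.G) l e.1.2)}
  | .add u e => (children u).val.map fun w => Source.reg (nodeOut e w)
  | .check u e => (Q.checkNbrs e).val.map fun e' => Source.reg (.add u e')
  | .vote u e => (Q.varNbrs e).val.map fun e' => Source.reg (.check u e')

/-- The stage in which an operation takes place: first all leaves, then the levels from the bottom
to the root, with three stages for each level. -/
def encodedTStage (L dT : ℕ) (E : Type) : TOp L (numInternal L dT) E → ℕ
  | .leaf _ _ => 0
  | .add u _ => 3 * (lastLevel L dT - level dT u) + 1
  | .check u _ => 3 * (lastLevel L dT - level dT u) + 2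
  | .vote u _ => 3 * (lastLevel L dT - level dT u) + 3

theorem encodedTStage_lt (L dT : ℕ) (E : Type) (o : TOp L (numInternal L dT) E) :
    encodedTStage L dT E o < 3 * lastLevel L dT + 4 := by
  cases o <;> simp only [encodedTStage] <;> omega

theorem encodedT_feasible (dT : ℕ) (hT : 2 ≤ dT) (A : Matrix (Fin L) (Fin K) (ZMod 2))
    (Q : LDPC N K dv dc) (o o' : TOp L (numInternal L dT) Q.Edge)
    (h : Source.reg o' ∈ encodedTInputs dT A Q o) :
    encodedTStage L dT Q.Edge o' < encodedTStage L dT Q.Edge o := by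
  cases o with
  | leaf l e => simp [encodedTInputs] at h
  | add u e =>
    simp only [encodedTInputs, Multiset.mem_map, Source.reg.injEq] at h
    obtain ⟨w, hw, rfl⟩ := h
    cases w with
    | inr l => simp [nodeOut, encodedTStage]
    | inl w =>
      simp only [children, Finset.mem_val, Finset.mem_filter, Finset.mem_univ, true_and,
        Node.index, Finset.mem_Icc] at hw
      have h1 := level_child hT hw.1
      have h2 := level_le_lastLevel w
      simp only [nodeOut, encodedTStage]
      omega
  | check u e =>
    simp only [encodedTInputs, Multiset.mem_map, Source.reg.injEq] at h
    obtain ⟨w, -, rfl⟩ := h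
    simp [encodedTStage]
  | vote u e =>
    simp only [encodedTInputs, Multiset.mem_map, Source.reg.injEq] at h
    obtain ⟨w, -, rfl⟩ := h
    simp [encodedTStage]

/-- The scheme ENCODED-T for `r = s A` with tree width `dT` and the LDPC code `Q`. The `k`-th
output is a randomly selected copy, kept at the root, of the `k`-th (systematic) bit of the
codeword. -/
abbrev encodedT (dT : ℕ) (hL : 2 ≤ L) (hT : 2 ≤ dT) (hdv : 0 < dv)
    (A : Matrix (Fin L) (Fin K) (ZMod 2)) (Q : LDPC N K dv dc) : Scheme L K where
  Op := TOp L (numInternal L dT) Q.Edge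
  fintypeOp := inferInstance
  stages := 3 * lastLevel L dT + 4
  stage o := ⟨encodedTStage L dT Q.Edge o, encodedTStage_lt L dT Q.Edge o⟩
  kind
    | .leaf _ _ => .and
    | .add _ _ => .xor
    | .check _ _ => .xor
    | .vote _ _ => .maj
  inputs := encodedTInputs dT A Q
  feasible o o' h := encodedT_feasible dT hT A Q o o' h
  output k :=
    (Finset.univ.filter fun e : Q.Edge => e.1.2 = Fin.castLE Q.dim_le k).map
      ⟨fun e => TOp.vote ⟨0, numInternal_pos hL hT⟩ e, fun a b h => by
        simpa using h⟩
  output_nonempty k := by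
    have h := Q.var_degree (Fin.castLE Q.dim_le k)
    have h0 : (Finset.univ.filter fun c => Q.H c (Fin.castLE Q.dim_le k) ≠ 0).Nonempty := by
      rw [← Finset.card_pos, h]; exact hdv
    obtain ⟨c, hc⟩ := h0
    simp only [Finset.mem_filter, Finset.mem_univ, true_and] at hc
    simp only [Finset.map_nonempty]
    exact ⟨⟨(c, Fin.castLE Q.dim_le k), hc⟩, by simp⟩

end EncodedT

/-! ### The threshold -/

/-- The threshold `p_thr`, where `d = ⌈(dv - 1) / 2⌉`. -/
def pThr (dv dc dT : ℕ) : ℝ :=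
  let d : ℝ := ⌈((dv : ℝ) - 1) / 2⌉₊
  ((dv - 1).choose ((dv - 1) / 2) : ℝ) ^ (-(1 / (d - 1))) * (dc : ℝ) ^ (-(d / (d - 1))) *
    (dT : ℝ) ^ (-(1 / (d - 1))) * ((dT : ℝ) + 1) ^ (-(d / (d - 1)))

end Encoded

end

/-!
The bit that a node of the computation tree keeps for an edge `(v, c)` of the Tanner graph should
be the `v`-th bit of the codeword `∑ s_l (A G)_l`, the sum being over the leaves below the node.
All these words lie in the code, so a node in which nothing goes wrong satisfies the parity checks,
and the word at the root is `s A G`, whose systematic part is `s A` (`nodeSum_root_systematic`).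

Whether a register is wrong is bounded by a condition on the gate failures alone: an outcome is
`Corrupted` if its gate fails, if an input of an XOR gate is corrupted, or if `d = dv / 2` of the
`dv - 1` inputs of a majority gate are corrupted. If fewer than `d` inputs of a majority gate are
wrong, then a strict majority is right. Thus an outcome that is not corrupted is correct, whatever
the input vector and the tie-breaking bits are (`memory_eq_of_not_corrupted`).

The `dv - 1` messages read by one majority gate are corrupted independently. Tracing back the
dependencies of such a message through the tree of nodes is walking through the Tanner graph
without backtracking, and the length of the walk is determined by the operation at which it
ends (`exists_walk_of_reads`). If two messages to the same gate depended on a common operation,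
there would be two distinct non-backtracking walks with the same ends and at most
`4 * lastLevel + 2` edges in total, hence a cycle of at most this length
(`walk_eq_of_length_add_lt_girth`). The girth condition together with the bound on `log L`
excludes this (`lt_girth_of_largeGirth`).

By a union bound and independence, if the bits of the children of a node are corrupted with
probability at most `(dT + 1) / dT * p`, where `p = pThr`, then sums of children are corrupted with
probability at most `(dT + 1) (1 + 1 / dc) p`, messages from check nodes with probability at most
`(dT + 1) dc p`, and the new bits with probability at most
`p_maj + (dv - 1).choose d * ((dT + 1) dc p) ^ d`. The threshold is chosen such that the last term
is `p / dT` (`choose_mul_pow_pThr`), so the bound carries over from the children to the node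
(`corruptionProb_vote_le`).
-/

noncomputable section

namespace Encoded

/-! ### Non-backtracking walks and the girth -/

/-- Non-backtracking walks with the same ends are equal if they are too short to enclose a cycle:
the graph formed by their edges has at most as many edges as the walks together, so that it is
acyclic, and a non-backtracking walk in an acyclic graph is the only path between its ends. -/
theorem walk_eq_of_length_add_lt_girth {V : Type*} {G : SimpleGraph V} {a b : V}
    (p q : G.Walk a b) (hp : p.edges.IsChain (· ≠ ·)) (hq : q.edges.IsChain (· ≠ ·))
    (hlen : p.length + q.length < G.girth) : p = q := by
  classical
  -- `H` is the graph formed by the edges of both walks.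
  set S : Finset (Sym2 V) := p.edges.toFinset ∪ q.edges.toFinset with hS
  set H : SimpleGraph V := SimpleGraph.fromEdgeSet (S : Set (Sym2 V)) with hH
  have hSG : ∀ e ∈ S, e ∈ G.edgeSet := by
    intro e he
    simp only [hS, Finset.mem_union, List.mem_toFinset] at he
    rcases he with he | he
    · exact p.edges_subset_edgeSet he
    · exact q.edges_subset_edgeSet he
  have hHS : H.edgeSet = S := by
    rw [hH, SimpleGraph.edgeSet_fromEdgeSet]
    refine sdiff_eq_left.2 (Set.disjoint_left.2 fun e he hd => ?_)
    exact G.not_isDiag_of_mem_edgeSet (hSG e he) hd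
  have hHG : H ≤ G := by
    rw [← SimpleGraph.edgeSet_subset_edgeSet, hHS]
    exact hSG
  have hpH : ∀ e ∈ p.edges, e ∈ H.edgeSet := fun e he => by
    rw [hHS]; simp [hS, he]
  have hqH : ∀ e ∈ q.edges, e ∈ H.edgeSet := fun e he => by
    rw [hHS]; simp [hS, he]
  by_cases hac : H.IsAcyclic
  · have h1 : (p.transfer H hpH).IsPath := by
      rw [hac.isPath_iff_isChain, SimpleGraph.Walk.edges_transfer]; exact hp
    have h2 : (q.transfer H hqH).IsPath := by
      rw [hac.isPath_iff_isChain, SimpleGraph.Walk.edges_transfer]; exact hq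
    have h3 := (hac.subsingleton_path a b).elim ⟨_, h1⟩ ⟨_, h2⟩
    have h4 : (p.transfer H hpH).support = (q.transfer H hqH).support := by
      exact congrArg (fun r => SimpleGraph.Walk.support r.1) h3
    rw [SimpleGraph.Walk.support_transfer, SimpleGraph.Walk.support_transfer] at h4
    exact SimpleGraph.Walk.ext_support h4
  · exfalso
    obtain ⟨v, w, hw, hwl⟩ := SimpleGraph.exists_girth_eq_length.2 hac
    have : Fintype H.edgeSet := Fintype.ofEquiv S (Equiv.setCongr hHS.symm)
    have hcard : H.edgeFinset = S := by
      ext e; rw [SimpleGraph.mem_edgeFinset, hHS]; rfl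
    have h1 : w.length ≤ S.card := by
      rw [← hcard]; exact hw.isCircuit.isTrail.length_le_card_edgeFinset
    have h2 : S.card ≤ p.length + q.length := by
      refine (Finset.card_union_le _ _).trans (add_le_add ?_ ?_)
      · exact (List.toFinset_card_le _).trans_eq p.length_edges
      · exact (List.toFinset_card_le _).trans_eq q.length_edges
    have h3 := SimpleGraph.girth_anti hHG hac
    omega

/-! ### The computation tree -/

section Tree

variable {L dT : ℕ}

theorem le_mul_numInternal (hT : 2 ≤ dT) : L ≤ (dT - 1) * numInternal L dT + 1 := by
  have h2 : (2 : ℚ) ≤ dT := by exact_mod_cast hT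
  have h := Nat.le_ceil (((L : ℚ) - 1) / ((dT : ℚ) - 1))
  rw [div_le_iff₀ (by linarith)] at h
  have h' : (L : ℚ) ≤ ((dT - 1 : ℕ) : ℚ) * (numInternal L dT : ℚ) + 1 := by
    rw [Nat.cast_sub (by omega), Nat.cast_one, numInternal]
    linarith
  exact_mod_cast h'

theorem mul_numInternal_lt (hL : 2 ≤ L) (hT : 2 ≤ dT) :
    (dT - 1) * (numInternal L dT - 1) + 1 < L := by
  have h1 : (2 : ℚ) ≤ L := by exact_mod_cast hL
  have h2 : (2 : ℚ) ≤ dT := by exact_mod_cast hT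
  have h := Nat.ceil_lt_add_one (a := ((L : ℚ) - 1) / ((dT : ℚ) - 1))
    (div_nonneg (by linarith) (by linarith))
  rw [← sub_lt_iff_lt_add, lt_div_iff₀ (by linarith)] at h
  have h' : (((dT - 1 : ℕ) : ℚ) * ((numInternal L dT - 1 : ℕ) : ℚ) + 1 : ℚ) < L := by
    rw [Nat.cast_sub (by omega), Nat.cast_sub (numInternal_pos hL hT), Nat.cast_one, numInternal]
    linarith
  exact_mod_cast h'

theorem mem_children {u : Fin (numInternal L dT)} {w : Node L dT} :
    w ∈ children u ↔ dT * u + 1 ≤ Node.index w ∧ Node.index w ≤ dT * u + dT := by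
  simp [children]

theorem Node.index_injective : Function.Injective (Node.index (L := L) (dT := dT)) := by
  rintro (u | l) (u' | l') h <;> simp only [Node.index] at h
  · exact congrArg _ (Fin.ext h)
  · omega
  · omega
  · exact congrArg _ (Fin.ext (by omega))

theorem Node.index_lt (w : Node L dT) : Node.index w < numInternal L dT + L := by
  rcases w with u | l <;> simp only [Node.index] <;> omega

theorem card_children_le (u : Fin (numInternal L dT)) : (children u).card ≤ dT := by
  calc (children u).card = ((children u).image Node.index).card :=
        (Finset.card_image_of_injective _ Node.index_injective).symm
    _ ≤ (Finset.Icc (dT * u + 1) (dT * u + dT)).card := by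
        refine Finset.card_le_card fun n hn => ?_
        obtain ⟨w, hw, rfl⟩ := Finset.mem_image.1 hn
        exact Finset.mem_Icc.2 (mem_children.1 hw)
    _ = dT := by rw [Nat.card_Icc]; omega

/-- The index of the parent of a node other than the root is that of a non-leaf node. -/
theorem Node.parent_lt (hT : 2 ≤ dT) (w : Node L dT) (hw : Node.index w ≠ 0) :
    (Node.index w - 1) / dT < numInternal L dT := by
  rw [Nat.div_lt_iff_lt_mul (by omega)]
  have h1 := Node.index_lt w
  have h2 := le_mul_numInternal (L := L) hT
  obtain ⟨k, rfl⟩ : ∃ k, dT = k + 1 := ⟨dT - 1, by omega⟩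
  simp only [Nat.add_sub_cancel] at h2
  rw [Nat.mul_succ, mul_comm]
  omega

theorem mem_children_iff_parent (hT : 2 ≤ dT) {u : Fin (numInternal L dT)} {w : Node L dT} :
    w ∈ children u ↔ Node.index w ≠ 0 ∧ (Node.index w - 1) / dT = u := by
  rw [mem_children, Nat.div_eq_iff (by omega)]
  have : (u : ℕ) * dT = dT * u := mul_comm _ _
  omega

/-- The number of tree edges between the root and the `n`-th node of a `dT`-branch tree listed
level by level, defined through the parents. -/
def depth (dT : ℕ) : ℕ → ℕ
  | 0 => 0
  | n + 1 => depth dT (n / dT) + 1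
decreasing_by exact Nat.lt_succ_of_le (Nat.div_le_self _ _)

theorem depth_child {u w : ℕ} (hT : 2 ≤ dT) (h1 : dT * u + 1 ≤ w) (h2 : w ≤ dT * u + dT) :
    depth dT w = depth dT u + 1 := by
  obtain ⟨n, rfl⟩ : ∃ n, w = n + 1 := ⟨w - 1, by omega⟩
  rw [depth]
  congr 2
  rw [Nat.div_eq_iff (by omega)]
  have : u * dT = dT * u := mul_comm _ _
  omega

theorem depth_le_level (hT : 2 ≤ dT) (n : ℕ) : depth dT n ≤ level dT n := by
  induction n using Nat.strong_induction_on with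
  | _ n ih =>
    cases n with
    | zero => simp [depth]
    | succ n =>
      rw [depth]
      refine (Nat.succ_le_succ (ih _ (Nat.lt_succ_of_le (Nat.div_le_self _ _)))).trans ?_
      exact level_child hT (Nat.succ_le_succ (Nat.mul_div_le n dT))

theorem depth_index_le (hT : 2 ≤ dT) (w : Node L dT) :
    depth dT (Node.index w) ≤ lastLevel L dT + 1 := by
  rcases Nat.eq_zero_or_eq_succ_pred (Node.index w) with h | h
  · rw [h, depth]; omega
  · rw [h, depth]
    have := Node.parent_lt hT w (by omega)
    exact Nat.succ_le_succ ((depth_le_level hT _).trans (level_le_lastLevel ⟨_, this⟩))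

/-- The number of levels with non-leaf nodes is at most `⌈log L / log dT⌉`. -/
theorem lastLevel_lt_clog (hL : 2 ≤ L) (hT : 2 ≤ dT) : lastLevel L dT + 1 ≤ Nat.clog dT L := by
  have h := mul_numInternal_lt hL hT
  refine Nat.succ_le_of_lt ((Nat.lt_clog_iff_pow_lt (by omega)).2 (lt_of_le_of_lt ?_ h))
  exact Nat.pow_log_le_self _ (by omega)

end Tree

/-! ### Failure patterns -/

section Failures

variable {L K N dv dc dT : ℕ} {Q : LDPC N K dv dc}

/-- A bound for the set of wrong registers that only looks at the gate failures `z`: the outcome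
of an operation is *corrupted* if its gate fails, if some input of an XOR gate is corrupted, or if
at least `dv / 2 = ⌈(dv - 1) / 2⌉` inputs of a majority gate are corrupted. The true value and the
tie-breaking bits play no role. -/
inductive Corrupted (z : TOp L (numInternal L dT) Q.Edge → ZMod 2) :
    TOp L (numInternal L dT) Q.Edge → Prop
  | fail {o} (h : z o = 1) : Corrupted z o
  | add {u e w} (hw : w ∈ children u) (h : Corrupted z (nodeOut e w)) : Corrupted z (.add u e)
  | check {u e e'} (he : e' ∈ Q.checkNbrs e) (h : Corrupted z (.add u e')) :
      Corrupted z (.check u e)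
  | vote {u e} (T : Finset Q.Edge) (hT : T ∈ (Q.varNbrs e).powersetCard (dv / 2))
      (h : ∀ e' ∈ T, Corrupted z (.check u e')) : Corrupted z (.vote u e)

/-- `Reads o o'` means that the register of `o'` is an input of the operation `o`. -/
inductive Reads : TOp L (numInternal L dT) Q.Edge → TOp L (numInternal L dT) Q.Edge → Prop
  | add {u e w} (hw : w ∈ children u) : Reads (.add u e) (nodeOut e w)
  | check {u e e'} (he : e' ∈ Q.checkNbrs e) : Reads (.check u e) (.add u e')
  | vote {u e e'} (he : e' ∈ Q.varNbrs e) : Reads (.vote u e) (.check u e')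

theorem Corrupted.congr {z z' : TOp L (numInternal L dT) Q.Edge → ZMod 2}
    {o : TOp L (numInternal L dT) Q.Edge} (h : Corrupted z o)
    (hz : ∀ o', Relation.ReflTransGen Reads o o' → z o' = z' o') : Corrupted z' o := by
  induction h with
  | fail h => exact .fail ((hz _ .refl).symm.trans h)
  | add hw _ ih => exact .add hw (ih fun o' ho => hz o' (.head (.add hw) ho))
  | check he _ ih => exact .check he (ih fun o' ho => hz o' (.head (.check he) ho))
  | vote T hT _ ih =>
    refine .vote T hT fun e' he' => ih e' he' fun o' ho => hz o' (.head (.vote ?_) ho)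
    exact (Finset.mem_powersetCard.1 hT).1 he'

theorem dependsOn_corrupted (o : TOp L (numInternal L dT) Q.Edge) :
    DependsOn (fun z => Corrupted z o) {o' | Relation.ReflTransGen Reads o o'} := fun _ _ h =>
  propext ⟨fun hz => hz.congr h, fun hz => hz.congr fun o' ho => (h o' ho).symm⟩

/-- An edge of the Tanner graph as an unordered pair of nodes. -/
def LDPC.Edge.toSym2 (e : Q.Edge) : Sym2 (Fin Q.numChecks ⊕ Fin N) :=
  s(Sum.inl e.1.1, Sum.inr e.1.2)

theorem LDPC.Edge.toSym2_injective : Function.Injective (LDPC.Edge.toSym2 (Q := Q)) := by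
  intro e e' h
  simp only [LDPC.Edge.toSym2, Sym2.eq_iff, Sum.inl.injEq, Sum.inr.injEq, reduceCtorEq, and_self,
    or_false] at h
  exact Subtype.ext (Prod.ext h.1 h.2)

theorem LDPC.Edge.adj (e : Q.Edge) : Q.tannerGraph.Adj (Sum.inl e.1.1) (Sum.inr e.1.2) := by
  rw [LDPC.tannerGraph, SimpleGraph.fromRel_adj]
  exact ⟨by simp, Or.inl ⟨_, _, rfl, rfl, e.2⟩⟩

/-- The edge of the Tanner graph to which an operation belongs. -/
def TOp.edge : TOp L (numInternal L dT) Q.Edge → Q.Edge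
  | .leaf _ e => e
  | .add _ e => e
  | .check _ e => e
  | .vote _ e => e

/-- The end of `TOp.edge` that comes first when the dependencies of an operation are traced back
through the Tanner graph. -/
def TOp.source : TOp L (numInternal L dT) Q.Edge → Fin Q.numChecks ⊕ Fin N
  | .leaf _ e => .inl e.1.1
  | .add _ e => .inl e.1.1
  | .check _ e => .inr e.1.2
  | .vote _ e => .inl e.1.1

/-- The number of edges of the Tanner graph that are traversed when the dependencies are traced
back from the root of the tree to an operation. -/
def TOp.position : TOp L (numInternal L dT) Q.Edge → ℕ
  | .leaf l _ => 2 * depth dT (Node.index (.inr l : Node L dT))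
  | .add u _ => 2 * depth dT u + 2
  | .check u _ => 2 * depth dT u + 1
  | .vote u _ => 2 * depth dT u

theorem TOp.position_le (hT : 2 ≤ dT) (o : TOp L (numInternal L dT) Q.Edge) :
    o.position ≤ 2 * lastLevel L dT + 2 := by
  have h : ∀ u : Fin (numInternal L dT), depth dT u ≤ lastLevel L dT := fun u =>
    (depth_le_level hT _).trans (level_le_lastLevel u)
  cases o with
  | leaf l e => have := depth_index_le hT (.inr l : Node L dT); simp only [position]; omega
  | add u e => have := h u; simp only [position]; omega
  | check u e => have := h u; simp only [position]; omega
  | vote u e => have := h u; simp only [position]; omega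

theorem isChain_edges_concat {V : Type*} {G : SimpleGraph V} {a b c : V} {x y z : Sym2 V}
    (p : G.Walk a b) (h : G.Adj b c) (hp : (p.edges ++ [x]).IsChain (· ≠ ·))
    (hz : (p.edges ++ [x]).head? = some z) (hx : s(b, c) = x) (hy : x ≠ y) :
    ((p.concat h).edges ++ [y]).IsChain (· ≠ ·) ∧ ((p.concat h).edges ++ [y]).head? = some z := by
  rw [SimpleGraph.Walk.edges_concat, hx, List.concat_eq_append]
  refine ⟨List.isChain_append.2 ⟨hp, by simp, by simpa using hy⟩, ?_⟩
  rw [List.head?_append, hz]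
  rfl

/-- Tracing back the dependencies of a message from a check node gives a non-backtracking walk in
the Tanner graph. The edge of the operation that is reached is not yet part of the walk: two walks
to the same operation share that edge, and leaving it out is what brings their total length down
to the bound in the girth condition. -/
theorem exists_walk_of_reads (hT : 2 ≤ dT) {u : Fin (numInternal L dT)} {e : Q.Edge}
    {o : TOp L (numInternal L dT) Q.Edge}
    (h : Relation.ReflTransGen Reads (TOp.check u e) o) :
    ∃ p : Q.tannerGraph.Walk (Sum.inr e.1.2) o.source,
      ((p.edges ++ [o.edge.toSym2]).IsChain (· ≠ ·) ∧
        (p.edges ++ [o.edge.toSym2]).head? = some e.toSym2) ∧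
      p.length + (2 * depth dT u + 1) = o.position := by
  induction h with
  | refl =>
    refine ⟨(SimpleGraph.Walk.nil : Q.tannerGraph.Walk (Sum.inr e.1.2) (Sum.inr e.1.2)), ?_, ?_⟩
    · exact ⟨List.isChain_singleton _, rfl⟩
    · exact Nat.zero_add _
  | tail _ hr ih =>
    obtain ⟨p, ⟨h1, h2⟩, h3⟩ := ih
    cases hr with
    | @add u' e' w hw =>
      have hd := depth_child hT (mem_children.1 hw).1 (mem_children.1 hw).2
      have h3 : p.length + (2 * depth dT u + 1) = 2 * depth dT u' + 2 := h3
      cases w with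
      | inl w =>
        refine ⟨p, ⟨h1, h2⟩, h3.trans ?_⟩
        change _ = 2 * depth dT (Node.index (.inl w : Node L dT))
        omega
      | inr l =>
        refine ⟨p, ⟨h1, h2⟩, h3.trans ?_⟩
        change _ = 2 * depth dT (Node.index (.inr l : Node L dT))
        omega
    | @check u' e' e'' he =>
      simp only [LDPC.checkNbrs, Finset.mem_filter, Finset.mem_univ, true_and] at he
      have hadj : Q.tannerGraph.Adj (Sum.inr e'.1.2) (Sum.inl e''.1.1) := by
        rw [he.1]; exact e'.adj.symm
      have hs : s(Sum.inr e'.1.2, Sum.inl e''.1.1) = e'.toSym2 := by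
        rw [he.1, LDPC.Edge.toSym2, Sym2.eq_swap]
      refine ⟨p.concat hadj, isChain_edges_concat p hadj h1 h2 hs
        fun h => he.2 (LDPC.Edge.toSym2_injective h).symm, ?_⟩
      have h3 : p.length + (2 * depth dT u + 1) = 2 * depth dT u' + 1 := h3
      have h4 : (p.concat hadj).length = p.length + 1 := p.length_concat hadj
      change (p.concat hadj).length + _ = 2 * depth dT u' + 2
      omega
    | @vote u' e' e'' he =>
      simp only [LDPC.varNbrs, Finset.mem_filter, Finset.mem_univ, true_and] at he
      have hadj : Q.tannerGraph.Adj (Sum.inl e'.1.1) (Sum.inr e''.1.2) := by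
        rw [he.1]; exact e'.adj
      have hs : s(Sum.inl e'.1.1, Sum.inr e''.1.2) = e'.toSym2 := by
        rw [he.1, LDPC.Edge.toSym2]
      refine ⟨p.concat hadj, isChain_edges_concat p hadj h1 h2 hs
        fun h => he.2 (LDPC.Edge.toSym2_injective h).symm, ?_⟩
      have h3 : p.length + (2 * depth dT u + 1) = 2 * depth dT u' := h3
      have h4 : (p.concat hadj).length = p.length + 1 := p.length_concat hadj
      change (p.concat hadj).length + _ = 2 * depth dT u' + 1
      omega

/-- Two messages from different check nodes to the same variable node have no operation in common
among their dependencies. -/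
theorem disjoint_reads_check (hT : 2 ≤ dT) (hg : 4 * lastLevel L dT + 2 < Q.tannerGraph.girth)
    {u : Fin (numInternal L dT)} {e e₁ e₂ : Q.Edge} (h₁ : e₁ ∈ Q.varNbrs e)
    (h₂ : e₂ ∈ Q.varNbrs e) (hne : e₁ ≠ e₂) :
    Disjoint {o | Relation.ReflTransGen Reads (TOp.check u e₁) o}
      {o | Relation.ReflTransGen Reads (TOp.check u e₂) o} := by
  simp only [LDPC.varNbrs, Finset.mem_filter, Finset.mem_univ, true_and] at h₁ h₂
  refine Set.disjoint_left.2 fun o ho₁ ho₂ => hne ?_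
  have hw₁ := exists_walk_of_reads hT ho₁
  have hw₂ := exists_walk_of_reads hT ho₂
  rw [h₁.1] at hw₁
  rw [h₂.1] at hw₂
  obtain ⟨p, ⟨hp1, hp2⟩, hp3⟩ := hw₁
  obtain ⟨q, ⟨hq1, hq2⟩, hq3⟩ := hw₂
  have ho := o.position_le hT
  have hpq : p = q := walk_eq_of_length_add_lt_girth p q (List.isChain_append.1 hp1).1
    (List.isChain_append.1 hq1).1 (by omega)
  rw [hpq, hq2] at hp2
  exact (LDPC.Edge.toSym2_injective (Option.some.inj hp2)).symm

end Failures

/-! ### Independence of failures of disjoint sets of gates -/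

open MeasureTheory ProbabilityTheory

theorem isProbabilityMeasure_bitLaw {p : ℝ} (h0 : 0 ≤ p) (h1 : p ≤ 1) :
    IsProbabilityMeasure (bitLaw p) := by
  refine ⟨?_⟩
  simp only [bitLaw, Measure.coe_add, Measure.coe_smul, Pi.add_apply, Pi.smul_apply,
    measure_univ, smul_eq_mul, mul_one]
  rw [← ENNReal.ofReal_add (by linarith) h0]
  simp

theorem bitLaw_singleton_one (p : ℝ) : bitLaw p {1} = ENNReal.ofReal p := by
  simp [bitLaw]

section Pi

variable {ι : Type*} [Fintype ι] {μ : ι → Measure (ZMod 2)} [∀ i, IsProbabilityMeasure (μ i)]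

/-- Events that depend on disjoint sets of coordinates are independent under a product measure. -/
theorem measureReal_pi_and_of_dependsOn {B C : (ι → ZMod 2) → Prop} {S T : Set ι}
    (hB : DependsOn B S) (hC : DependsOn C T) (hST : Disjoint S T) :
    (Measure.pi μ).real {z | B z ∧ C z} =
      (Measure.pi μ).real {z | B z} * (Measure.pi μ).real {z | C z} := by
  classical
  have hind : iIndepFun (fun i (z : ι → ZMod 2) => z i) (Measure.pi μ) :=
    iIndepFun_pi (X := fun _ => id) fun _ => aemeasurable_id
  have h := hind.indepFun_finset S.toFinset T.toFinset (by simpa using hST)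
    fun i => measurable_pi_apply i
  have key : ∀ (B : (ι → ZMod 2) → Prop) (S : Set ι), DependsOn B S →
      {z | B z} = (fun z (i : S.toFinset) => z i) ⁻¹'
        ((fun z (i : S.toFinset) => z i) '' {z | B z}) := by
    intro B S hB
    refine Set.Subset.antisymm (Set.subset_preimage_image _ _) ?_
    rintro z ⟨z', hz', hzz⟩
    have : B z' = B z := hB fun i hi => congrFun hzz ⟨i, by simpa using hi⟩
    exact this.mp hz'
  have h2 := h.measure_inter_preimage_eq_mul
    ((fun z (i : S.toFinset) => z i) '' {z | B z})
    ((fun z (i : T.toFinset) => z i) '' {z | C z})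
    (Set.toFinite _).measurableSet (Set.toFinite _).measurableSet
  rw [← key B S hB, ← key C T hC] at h2
  simp only [measureReal_def]
  rw [← ENNReal.toReal_mul, ← h2]
  rfl

theorem measureReal_pi_forall_of_dependsOn {κ : Type*} (T : Finset κ)
    {B : κ → (ι → ZMod 2) → Prop} {S : κ → Set ι} (hB : ∀ k, DependsOn (B k) (S k))
    (hS : ∀ k ∈ T, ∀ l ∈ T, k ≠ l → Disjoint (S k) (S l)) :
    (Measure.pi μ).real {z | ∀ k ∈ T, B k z} = ∏ k ∈ T, (Measure.pi μ).real {z | B k z} := by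
  classical
  induction T using Finset.induction_on with
  | empty => simp
  | insert k T hk ih =>
    rw [Finset.prod_insert hk, ← ih fun a ha b hb =>
      hS a (Finset.mem_insert_of_mem ha) b (Finset.mem_insert_of_mem hb)]
    simp only [Finset.forall_mem_insert]
    refine measureReal_pi_and_of_dependsOn (T := ⋃ l ∈ T, S l) (hB k) (fun z z' h => ?_) ?_
    · refine propext (forall₂_congr fun l hl => ?_)
      rw [hB l fun i hi => h i (Set.mem_biUnion hl hi)]
    · refine Set.disjoint_iUnion₂_right.2 fun l hl => ?_
      exact hS k (Finset.mem_insert_self _ _) l (Finset.mem_insert_of_mem hl)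
        fun h => hk (h ▸ hl)

end Pi

/-! ### Cardinalities in the Tanner graph -/

section Card

variable {N K dv dc : ℕ} {Q : LDPC N K dv dc}

theorem card_edges_at_var (v : Fin N) :
    (Finset.univ.filter fun e : Q.Edge => e.1.2 = v).card = dv := by
  refine Eq.trans ?_ (Q.var_degree v)
  refine Finset.card_bij' (fun e _ => e.1.1) (fun c hc => ⟨(c, v), (Finset.mem_filter.1 hc).2⟩)
    ?_ ?_ ?_ ?_
  · intro e he
    simp only [Finset.mem_filter, Finset.mem_univ, true_and] at he ⊢
    rw [← he]; exact e.2
  · intro c hc; simp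
  · intro e he
    simp only [Finset.mem_filter, Finset.mem_univ, true_and] at he
    exact Subtype.ext (Prod.ext rfl he.symm)
  · intro c hc; rfl

theorem card_edges_at_check (c : Fin Q.numChecks) :
    (Finset.univ.filter fun e : Q.Edge => e.1.1 = c).card = dc := by
  refine Eq.trans ?_ (Q.check_degree c)
  refine Finset.card_bij' (fun e _ => e.1.2) (fun v hv => ⟨(c, v), (Finset.mem_filter.1 hv).2⟩)
    ?_ ?_ ?_ ?_
  · intro e he
    simp only [Finset.mem_filter, Finset.mem_univ, true_and] at he ⊢
    rw [← he]; exact e.2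
  · intro c hc; simp
  · intro e he
    simp only [Finset.mem_filter, Finset.mem_univ, true_and] at he
    exact Subtype.ext (Prod.ext he.symm rfl)
  · intro c hc; rfl

theorem varNbrs_eq_erase (e : Q.Edge) :
    Q.varNbrs e = (Finset.univ.filter fun e' : Q.Edge => e'.1.2 = e.1.2).erase e := by
  ext e'
  simp [LDPC.varNbrs, and_comm]

theorem checkNbrs_eq_erase (e : Q.Edge) :
    Q.checkNbrs e = (Finset.univ.filter fun e' : Q.Edge => e'.1.1 = e.1.1).erase e := by
  ext e'
  simp [LDPC.checkNbrs, and_comm]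

theorem card_varNbrs (e : Q.Edge) : (Q.varNbrs e).card = dv - 1 := by
  rw [varNbrs_eq_erase, Finset.card_erase_of_mem (by simp), card_edges_at_var]

theorem card_checkNbrs (e : Q.Edge) : (Q.checkNbrs e).card = dc - 1 := by
  rw [checkNbrs_eq_erase, Finset.card_erase_of_mem (by simp), card_edges_at_check]

theorem card_edge : Fintype.card Q.Edge = dv * N := by
  rw [← Finset.card_univ, Finset.card_eq_sum_card_fiberwise
    (f := fun e : Q.Edge => e.1.2) (t := Finset.univ) (fun _ _ => Finset.mem_coe.2 (Finset.mem_univ _))]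
  simp [card_edges_at_var, mul_comm]

end Card

/-! ### The threshold -/

section Threshold

theorem ceil_half {dv : ℕ} (hdv : 4 ≤ dv) : ⌈((dv : ℝ) - 1) / 2⌉₊ = dv / 2 := by
  rw [Nat.ceil_eq_iff (by omega)]
  have h1 : ((dv / 2 - 1 : ℕ) : ℝ) * 2 + 2 ≤ dv := by
    have : (dv / 2 - 1) * 2 + 2 ≤ dv := by omega
    exact_mod_cast this
  have h2 : (dv : ℝ) ≤ (dv / 2 : ℕ) * 2 + 1 := by
    have : dv ≤ (dv / 2) * 2 + 1 := by omega
    exact_mod_cast this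
  constructor <;> linarith

theorem pThr_pos {dv dc dT : ℕ} (hdc : 4 ≤ dc) (hT : 2 ≤ dT) :
    0 < pThr dv dc dT := by
  have h1 : (0 : ℝ) < ((dv - 1).choose ((dv - 1) / 2) : ℝ) := by
    exact_mod_cast Nat.choose_pos (by omega)
  have h2 : (0 : ℝ) < dc := by positivity
  have h3 : (0 : ℝ) < dT := by positivity
  unfold pThr
  positivity

/-- At the threshold, the probability that `d = dv / 2` given messages are all wrong, summed over
the choices of the messages, is `p / dT`, if each message is wrong with probability
`(dT + 1) dc p`. -/
theorem choose_mul_pow_pThr {dv dc dT : ℕ} (hdv : 4 ≤ dv) (hdc : 4 ≤ dc) (hT : 2 ≤ dT) :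
    ((dv - 1).choose (dv / 2) : ℝ) * (((dT : ℝ) + 1) * dc * pThr dv dc dT) ^ (dv / 2) =
      pThr dv dc dT / dT := by
  have hp := pThr_pos (dv := dv) hdc hT
  have hC : (dv - 1).choose (dv / 2) = (dv - 1).choose ((dv - 1) / 2) :=
    Nat.choose_symm_of_eq_add (by omega)
  have h1 : (0 : ℝ) < ((dv - 1).choose ((dv - 1) / 2) : ℝ) := by
    exact_mod_cast Nat.choose_pos (by omega)
  have h2 : (0 : ℝ) < dc := by positivity
  have h3 : (0 : ℝ) < dT := by positivity
  obtain ⟨k, hk⟩ : ∃ k, dv / 2 = k + 1 := ⟨dv / 2 - 1, by omega⟩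
  have hk0 : (k : ℝ) ≠ 0 := by
    have : k ≠ 0 := by omega
    exact_mod_cast this
  have hpow : pThr dv dc dT ^ k = (((dv - 1).choose ((dv - 1) / 2) : ℝ) * (dc : ℝ) ^ (k + 1) *
      dT * ((dT : ℝ) + 1) ^ (k + 1))⁻¹ := by
    have e1 : -(1 / (((k + 1 : ℕ) : ℝ) - 1)) * k = -1 := by
      push_cast; rw [add_sub_cancel_right]; field_simp
    have e2 : -(((k + 1 : ℕ) : ℝ) / (((k + 1 : ℕ) : ℝ) - 1)) * k = -((k + 1 : ℕ) : ℝ) := by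
      push_cast; rw [add_sub_cancel_right]; field_simp
    simp only [pThr, ceil_half hdv, hk]
    rw [mul_pow, mul_pow, mul_pow, ← Real.rpow_mul_natCast h1.le, ← Real.rpow_mul_natCast h2.le,
      ← Real.rpow_mul_natCast h3.le, ← Real.rpow_mul_natCast (by positivity), e1, e2,
      Real.rpow_neg_one, Real.rpow_neg_one, Real.rpow_neg h2.le,
      Real.rpow_neg (by positivity : (0 : ℝ) ≤ (dT : ℝ) + 1), Real.rpow_natCast,
      Real.rpow_natCast]
    simp only [mul_inv]
  rw [hC, hk, mul_pow, mul_pow, pow_succ (pThr dv dc dT), hpow]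
  field_simp

/-- This bounds every admissible gate failure probability by `1`, so that `bitLaw` is a probability
measure. -/
theorem pThr_mul_le_one {dv dc dT : ℕ} (hdv : 4 ≤ dv) (hdc : 4 ≤ dc) (hT : 2 ≤ dT) :
    ((dT : ℝ) + 1) * dc * pThr dv dc dT ≤ 1 := by
  have hp := pThr_pos (dv := dv) hdc hT
  have key := choose_mul_pow_pThr hdv hdc hT
  have hdc' : (4 : ℝ) ≤ dc := by exact_mod_cast hdc
  have hT' : (2 : ℝ) ≤ dT := by exact_mod_cast hT
  have hC : (1 : ℝ) ≤ ((dv - 1).choose (dv / 2) : ℝ) := by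
    exact_mod_cast Nat.choose_pos (by omega)
  set p := pThr dv dc dT
  set q := ((dT : ℝ) + 1) * dc * p with hq
  by_contra hlt
  have hlt : 1 < q := not_le.1 hlt
  have h1 : q ≤ q ^ (dv / 2) := le_self_pow₀ hlt.le (by omega)
  have h2 : q ^ (dv / 2) ≤ p / dT := by
    rw [← key]; exact le_mul_of_one_le_left (by positivity) hC
  have h3 : p / dT ≤ p := div_le_self hp.le (by linarith)
  have h4 : p < q := by
    rw [hq]
    have : 1 < ((dT : ℝ) + 1) * dc := by nlinarith
    exact lt_mul_of_one_lt_left hp this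
  linarith

end Threshold

/-! ### The recursion for the probability of corruption -/

section Corruption

variable {L K N dv dc dT : ℕ} {Q : LDPC N K dv dc}
  {η : TOp L (numInternal L dT) Q.Edge → ℝ}

/-- The probability that the outcome of an operation is corrupted, if each operation `o` fails
with probability `η o`, independently of the others. -/
def corruptionProb (η : TOp L (numInternal L dT) Q.Edge → ℝ)
    (o : TOp L (numInternal L dT) Q.Edge) : ℝ :=
  (Measure.pi fun o => bitLaw (η o)).real {z | Corrupted z o}

variable [∀ o, IsProbabilityMeasure (bitLaw (η o))]

theorem measureReal_fail {o : TOp L (numInternal L dT) Q.Edge} (h : 0 ≤ η o) :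
    (Measure.pi fun o => bitLaw (η o)).real {z | z o = 1} = η o := by
  have := (measurePreserving_eval (fun o => bitLaw (η o)) o).measureReal_preimage
    (s := {1}) (Set.toFinite _).measurableSet.nullMeasurableSet
  rw [measureReal_def (bitLaw (η o)), bitLaw_singleton_one, ENNReal.toReal_ofReal h] at this
  exact this

theorem corruptionProb_leaf (hη : ∀ o, 0 ≤ η o) (l : Fin L) (e : Q.Edge) :
    corruptionProb η (.leaf l e) ≤ η (.leaf l e) := by
  rw [corruptionProb, ← measureReal_fail (hη (.leaf l e))]
  refine measureReal_mono fun z hz => ?_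
  cases hz with
  | fail h => exact h

theorem corruptionProb_add (hη : ∀ o, 0 ≤ η o) (u : Fin (numInternal L dT)) (e : Q.Edge) :
    corruptionProb η (.add u e) ≤
      η (.add u e) + ∑ w ∈ children u, corruptionProb η (nodeOut e w) := by
  have hsub : {z | Corrupted z (.add u e)} ⊆
      {z | z (.add u e) = 1} ∪ ⋃ w ∈ children u, {z | Corrupted z (nodeOut e w)} := by
    intro z hz
    cases hz with
    | fail h => exact Or.inl h
    | add hw h => exact Or.inr (Set.mem_biUnion (Finset.mem_coe.2 hw) h)
  refine (measureReal_mono hsub).trans ((measureReal_union_le _ _).trans ?_)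
  rw [measureReal_fail (hη _)]
  exact add_le_add le_rfl (measureReal_biUnion_finset_le _ _)

theorem corruptionProb_check (hη : ∀ o, 0 ≤ η o) (u : Fin (numInternal L dT)) (e : Q.Edge) :
    corruptionProb η (.check u e) ≤
      η (.check u e) + ∑ e' ∈ Q.checkNbrs e, corruptionProb η (.add u e') := by
  have hsub : {z | Corrupted z (.check u e)} ⊆
      {z | z (.check u e) = 1} ∪ ⋃ e' ∈ Q.checkNbrs e, {z | Corrupted z (.add u e')} := by
    intro z hz
    cases hz with
    | fail h => exact Or.inl h
    | check he h => exact Or.inr (Set.mem_biUnion (Finset.mem_coe.2 he) h)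
  refine (measureReal_mono hsub).trans ((measureReal_union_le _ _).trans ?_)
  rw [measureReal_fail (hη _)]
  exact add_le_add le_rfl (measureReal_biUnion_finset_le _ _)

/-- The messages to a majority gate are corrupted independently, because the girth is large. -/
theorem corruptionProb_vote (hT : 2 ≤ dT) (hg : 4 * lastLevel L dT + 2 < Q.tannerGraph.girth)
    (hη : ∀ o, 0 ≤ η o) (u : Fin (numInternal L dT)) (e : Q.Edge) :
    corruptionProb η (.vote u e) ≤ η (.vote u e) +
      ∑ T ∈ (Q.varNbrs e).powersetCard (dv / 2), ∏ e' ∈ T, corruptionProb η (.check u e') := by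
  have hsub : {z | Corrupted z (.vote u e)} ⊆
      {z | z (.vote u e) = 1} ∪ ⋃ T ∈ (Q.varNbrs e).powersetCard (dv / 2),
        {z | ∀ e' ∈ T, Corrupted z (.check u e')} := by
    intro z hz
    cases hz with
    | fail h => exact Or.inl h
    | vote T hT h => exact Or.inr (Set.mem_biUnion (Finset.mem_coe.2 hT) h)
  refine (measureReal_mono hsub).trans ((measureReal_union_le _ _).trans ?_)
  rw [measureReal_fail (hη _)]
  refine add_le_add le_rfl ((measureReal_biUnion_finset_le _ _).trans (Finset.sum_le_sum ?_))
  intro T hTT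
  have hsubT := (Finset.mem_powersetCard.1 hTT).1
  refine (measureReal_pi_forall_of_dependsOn T (B := fun e' z => Corrupted z (.check u e'))
    (fun e' => dependsOn_corrupted _) fun e₁ h₁ e₂ h₂ hne => ?_).le
  exact disjoint_reads_check hT hg (hsubT h₁) (hsubT h₂) hne

/-- The threshold is chosen such that a bound for the corruption of the children of a node carries
over to the node. -/
theorem corruptionProb_vote_le (hdv : 4 ≤ dv) (hdc : 4 ≤ dc) (hT : 2 ≤ dT)
    (hg : 4 * lastLevel L dT + 2 < Q.tannerGraph.girth) (hη : ∀ o, 0 ≤ η o)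
    (hadd : ∀ u e, η (.add u e) ≤ ((dT : ℝ) + 1) / dc * pThr dv dc dT)
    (hcheck : ∀ u e, η (.check u e) ≤ ((dT : ℝ) + 1) / dc * pThr dv dc dT)
    (u : Fin (numInternal L dT))
    (hw : ∀ w ∈ children u, ∀ e : Q.Edge,
      corruptionProb η (nodeOut e w) ≤ ((dT : ℝ) + 1) / dT * pThr dv dc dT) (e : Q.Edge) :
    corruptionProb η (.vote u e) ≤ η (.vote u e) + pThr dv dc dT / dT := by
  have hp := pThr_pos (dv := dv) hdc hT
  have hdc' : (4 : ℝ) ≤ dc := by exact_mod_cast hdc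
  have hT' : (2 : ℝ) ≤ dT := by exact_mod_cast hT
  have key := choose_mul_pow_pThr hdv hdc hT
  set p := pThr dv dc dT
  have h1 : ∀ e, corruptionProb η (.add u e) ≤ ((dT : ℝ) + 1) / dc * p + (dT + 1) * p := by
    intro e
    refine (corruptionProb_add hη u e).trans (add_le_add (hadd u e) ?_)
    refine (Finset.sum_le_card_nsmul _ _ _ fun w h => hw w h e).trans ?_
    have hc : ((children u).card : ℝ) ≤ dT := by exact_mod_cast card_children_le u
    rw [nsmul_eq_mul]
    calc ((children u).card : ℝ) * (((dT : ℝ) + 1) / dT * p)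
        ≤ dT * (((dT : ℝ) + 1) / dT * p) := by gcongr
      _ = (dT + 1) * p := by field_simp
  have h2 : ∀ e, corruptionProb η (.check u e) ≤ ((dT : ℝ) + 1) * dc * p := by
    intro e
    refine (corruptionProb_check hη u e).trans
      ((add_le_add (hcheck u e) (Finset.sum_le_card_nsmul _ _ _ fun e' _ => h1 e')).trans ?_)
    rw [nsmul_eq_mul, card_checkNbrs, Nat.cast_sub (by omega), Nat.cast_one]
    apply le_of_eq
    field_simp
    ring
  refine (corruptionProb_vote hT hg hη u e).trans (add_le_add le_rfl ?_)
  calc ∑ T ∈ (Q.varNbrs e).powersetCard (dv / 2), ∏ e' ∈ T, corruptionProb η (.check u e')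
      ≤ ∑ T ∈ (Q.varNbrs e).powersetCard (dv / 2), (((dT : ℝ) + 1) * dc * p) ^ (dv / 2) := by
        refine Finset.sum_le_sum fun T hTT => ?_
        rw [← (Finset.mem_powersetCard.1 hTT).2]
        exact (Finset.prod_le_prod (fun _ _ => measureReal_nonneg) fun e' _ => h2 e').trans_eq
          (Finset.prod_const _)
    _ = p / dT := by
        rw [Finset.sum_const, Finset.card_powersetCard, card_varNbrs, nsmul_eq_mul, key]

theorem corruptionProb_nodeOut_le (hdv : 4 ≤ dv) (hdc : 4 ≤ dc) (hT : 2 ≤ dT)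
    (hg : 4 * lastLevel L dT + 2 < Q.tannerGraph.girth) (hη : ∀ o, 0 ≤ η o)
    (hleaf : ∀ l e, η (.leaf l e) ≤ ((dT : ℝ) + 1) / dT * pThr dv dc dT)
    (hadd : ∀ u e, η (.add u e) ≤ ((dT : ℝ) + 1) / dc * pThr dv dc dT)
    (hcheck : ∀ u e, η (.check u e) ≤ ((dT : ℝ) + 1) / dc * pThr dv dc dT)
    (hvote : ∀ u e, η (.vote u e) ≤ pThr dv dc dT) (w : Node L dT) (e : Q.Edge) :
    corruptionProb η (nodeOut e w) ≤ ((dT : ℝ) + 1) / dT * pThr dv dc dT := by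
  induction h : numInternal L dT + L - Node.index w using Nat.strong_induction_on
    generalizing w e with
  | _ n ih =>
    cases w with
    | inr l => exact (corruptionProb_leaf hη l e).trans (hleaf l e)
    | inl u =>
      have hT' : (2 : ℝ) ≤ dT := by exact_mod_cast hT
      refine (corruptionProb_vote_le hdv hdc hT hg hη hadd hcheck u (fun w hw e => ?_) e).trans ?_
      · refine ih _ ?_ w e rfl
        have h1 := (mem_children.1 hw).1
        have h2 := Node.index_lt w
        have h3 : 1 * (u : ℕ) ≤ dT * u := Nat.mul_le_mul_right _ (by omega)
        simp only [Node.index] at h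
        omega
      · refine (add_le_add (hvote u e) le_rfl).trans_eq ?_
        field_simp

end Corruption

/-! ### Contents of the registers -/

section Memory

theorem majority_eq {z x : ZMod 2} {u : Multiset (ZMod 2)} (h : u.card / 2 + 1 ≤ u.count x) :
    majority z u = x := by
  have hsum : u.count 0 + u.count 1 = u.card := by
    rw [← Multiset.sum_count_eq_card (s := Finset.univ) fun a _ => Finset.mem_univ a]
    exact (Fin.sum_univ_two fun a : ZMod 2 => u.count a).symm
  have hx : x = 0 ∨ x = 1 := by clear h; revert x; decide
  unfold majority
  rcases hx with rfl | rfl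
  · rw [if_pos h]
  · rw [if_neg (by omega), if_pos h]

variable {L K : ℕ} (C : Scheme L K)

/-- A register does not change after the stage of its operation. -/
theorem Scheme.memory_of_lt (s : Fin L → ZMod 2) (z c : C.Op → ZMod 2) {t : ℕ} {o : C.Op}
    (h : (C.stage o : ℕ) < t) :
    C.memory s z c t o = C.memory s z c (C.stage o + 1) o := by
  induction t with
  | zero => omega
  | succ t ih =>
    rcases Nat.lt_succ_iff_lt_or_eq.1 h with h' | h'
    · rw [← ih h']; exact if_neg h'.ne
    · rw [h']

/-- At the end of the computation, every register holds the outcome of its operation applied to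
the final contents of the registers: by feasibility, what an operation reads never changes
afterwards. -/
theorem Scheme.memory_stages (s : Fin L → ZMod 2) (z c : C.Op → ZMod 2) (o : C.Op) :
    C.memory s z c C.stages o =
      (C.kind o).eval (c o) ((C.inputs o).map (Source.read s (C.memory s z c C.stages))) + z o := by
  rw [C.memory_of_lt s z c (C.stage o).2]
  refine (if_pos rfl).trans ?_
  congr 2
  refine Multiset.map_congr rfl fun x hx => ?_
  cases x with
  | input l => rfl
  | const b => rfl
  | reg o' =>
    have h := C.feasible o o' hx
    rw [Source.read, Source.read, C.memory_of_lt s z c h, C.memory_of_lt s z c (C.stage o').2]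

theorem Scheme.opCount_eq : C.opCount = Fintype.card C.Op := by
  unfold Scheme.opCount
  rw [← Nat.card_eq_fintype_card, ← Nat.card_congr (Equiv.sigmaFiberEquiv C.stage), Nat.card_sigma]

end Memory

/-! ### The values at the nodes of the computation tree -/

section NodeSum

variable {L dT : ℕ} {M : Type*}

/-- The sum of the values of `f` at the leaves below a node of the computation tree. -/
def nodeSum [AddCommMonoid M] (f : Fin L → M) : Node L dT → M
  | .inr l => f l
  | .inl u => ∑ w ∈ (children u).attach, nodeSum f w.1
termination_by w => numInternal L dT + L - Node.index w
decreasing_by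
  have h1 := (mem_children.1 w.2).1
  have h2 := Node.index_lt w.1
  have h3 : (u : ℕ) ≤ dT * u := by
    rcases Nat.eq_zero_or_pos dT with rfl | h
    · have := (mem_children.1 w.2).2
      omega
    · exact Nat.le_mul_of_pos_left _ h
  simp only [Node.index] at h1 h2 ⊢
  omega

theorem nodeSum_inr [AddCommMonoid M] (f : Fin L → M) (l : Fin L) :
    nodeSum f (.inr l : Node L dT) = f l := by
  rw [nodeSum]

theorem nodeSum_inl [AddCommMonoid M] (f : Fin L → M) (u : Fin (numInternal L dT)) :
    nodeSum f (.inl u : Node L dT) = ∑ w ∈ children u, nodeSum f w := by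
  rw [nodeSum, Finset.sum_attach (children u) fun w => nodeSum f w]

theorem nodeSum_mem {R : Type*} [Semiring R] [AddCommMonoid M] [Module R M] (V : Submodule R M)
    (f : Fin L → M) (hT : 2 ≤ dT) (hf : ∀ l, f l ∈ V) (w : Node L dT) : nodeSum f w ∈ V := by
  induction h : numInternal L dT + L - Node.index w using Nat.strong_induction_on
    generalizing w with
  | _ n ih =>
    cases w with
    | inr l => rw [nodeSum_inr]; exact hf l
    | inl u =>
      rw [nodeSum_inl]
      refine V.sum_mem fun w hw => ih _ ?_ w rfl
      have h1 := (mem_children.1 hw).1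
      have h2 := Node.index_lt w
      have h3 : 1 * (u : ℕ) ≤ dT * u := Nat.mul_le_mul_right _ (by omega)
      simp only [Node.index] at h
      omega

/-- Summing the recursion over all non-leaf nodes, every node but the root occurs exactly once as
a child. -/
theorem nodeSum_root [AddCommGroup M] (f : Fin L → M) (hL : 2 ≤ L) (hT : 2 ≤ dT) :
    nodeSum f (.inl ⟨0, numInternal_pos hL hT⟩ : Node L dT) = ∑ l, f l := by
  classical
  set r : Node L dT := .inl ⟨0, numInternal_pos hL hT⟩ with hr
  have hroot : ∀ w : Node L dT, Node.index w = 0 ↔ w = r := fun w =>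
    ⟨fun h => Node.index_injective (h.trans rfl), fun h => h ▸ rfl⟩
  have h1 : ∑ u : Fin (numInternal L dT), nodeSum f (.inl u : Node L dT) =
      ∑ w ∈ Finset.univ.erase r, nodeSum f w := by
    simp only [nodeSum_inl]
    rw [← Finset.sum_biUnion]
    · refine Finset.sum_congr ?_ fun _ _ => rfl
      ext w
      simp only [Finset.mem_biUnion, Finset.mem_univ, true_and, Finset.mem_erase, and_true,
        mem_children_iff_parent hT]
      refine ⟨fun ⟨_, h, _⟩ hw => h ((hroot w).2 hw), fun h => ?_⟩
      have h' : Node.index w ≠ 0 := fun h0 => h ((hroot w).1 h0)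
      exact ⟨⟨_, Node.parent_lt hT w h'⟩, h', rfl⟩
    · intro u _ u' _ hne
      refine Finset.disjoint_left.2 fun w hw hw' => hne (Fin.ext ?_)
      rw [← ((mem_children_iff_parent hT).1 hw).2, ((mem_children_iff_parent hT).1 hw').2]
  have h2 : ∑ w : Node L dT, nodeSum f w =
      ∑ u, nodeSum f (.inl u : Node L dT) + ∑ l, f l := by
    rw [Fintype.sum_sum_type]
    simp only [nodeSum_inr]
  rw [← Finset.add_sum_erase _ _ (Finset.mem_univ r), h1, add_comm] at h2
  exact add_left_cancel h2

end NodeSum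

/-! ### Correctness in the absence of corruption -/

section Correctness

variable {L K N dv dc dT : ℕ}

/-- A Gallager-B message from a check node is correct if the bits it is computed from are those of
a codeword. -/
theorem sum_checkNbrs {Q : LDPC N K dv dc} {x : Fin N → ZMod 2}
    (hx : x ∈ LinearMap.ker Q.H.mulVecLin) (e : Q.Edge) :
    ∑ e' ∈ Q.checkNbrs e, x e'.1.2 = x e.1.2 := by
  have h0 : ∑ v, Q.H e.1.1 v * x v = 0 := congrFun (LinearMap.mem_ker.1 hx) e.1.1
  have h1 : ∑ e' : Q.Edge with e'.1.1 = e.1.1, x e'.1.2 = ∑ v, Q.H e.1.1 v * x v := by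
    rw [← Finset.sum_filter_of_ne (p := fun v => Q.H e.1.1 v ≠ 0)
      (fun v _ h => left_ne_zero_of_mul h)]
    refine Finset.sum_bij' (fun e' _ => e'.1.2)
      (fun v hv => ⟨(e.1.1, v), (Finset.mem_filter.1 hv).2⟩) ?_ ?_ ?_ ?_ ?_
    · intro e' he'
      simp only [Finset.mem_filter, Finset.mem_univ, true_and] at he' ⊢
      rw [← he']; exact e'.2
    · intro v hv; simp
    · intro e' he'
      simp only [Finset.mem_filter, Finset.mem_univ, true_and] at he'
      exact Subtype.ext (Prod.ext he'.symm rfl)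
    · intro v hv; rfl
    · intro e' he'
      simp only [Finset.mem_filter, Finset.mem_univ, true_and] at he'
      have hone : ∀ a : ZMod 2, a ≠ 0 → a = 1 := by decide
      rw [← he', hone _ e'.2, one_mul]
  rw [checkNbrs_eq_erase]
  have h2 := Finset.add_sum_erase (Finset.univ.filter fun e' : Q.Edge => e'.1.1 = e.1.1)
    (fun e' => x e'.1.2) (a := e) (by simp)
  rw [h1, h0] at h2
  rw [← ZMod.neg_eq_self_mod_two (x e.1.2)]
  exact (neg_eq_of_add_eq_zero_right h2).symm

/-- The node of the computation tree to which an operation belongs. -/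
def TOp.node {E : Type} : TOp L (numInternal L dT) E → Node L dT
  | .leaf l _ => .inr l
  | .add u _ => .inl u
  | .check u _ => .inl u
  | .vote u _ => .inl u

/-- An outcome that is not corrupted is the bit, for the variable node of the edge, of the codeword
that belongs to the tree node. -/
theorem memory_eq_of_not_corrupted (hL : 2 ≤ L) (hT : 2 ≤ dT) (hdv : 0 < dv)
    (A : Matrix (Fin L) (Fin K) (ZMod 2)) (Q : LDPC N K dv dc) (s : Fin L → ZMod 2)
    (z c : TOp L (numInternal L dT) Q.Edge → ZMod 2) (o : TOp L (numInternal L dT) Q.Edge)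
    (ho : ¬ Corrupted z o) :
    (encodedT dT hL hT hdv A Q).memory s z c (encodedT dT hL hT hdv A Q).stages o =
      nodeSum (fun l => s l • (A * Q.G) l) o.node o.edge.1.2 := by
  set C := encodedT dT hL hT hdv A Q with hC
  set m : TOp L (numInternal L dT) Q.Edge → ZMod 2 := C.memory s z c C.stages with hm
  set f : Fin L → Fin N → ZMod 2 := fun l => s l • (A * Q.G) l with hf
  have hcode : ∀ w : Node L dT, nodeSum f w ∈ LinearMap.ker Q.H.mulVecLin := by
    refine nodeSum_mem _ f hT fun l => ?_
    rw [← Q.span_rows]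
    refine Submodule.smul_mem _ _ ?_
    have : (A * Q.G) l = ∑ k, A l k • Q.G.row k := by
      ext v
      simp [Matrix.mul_apply, Finset.sum_apply]
    rw [this]
    exact Submodule.sum_mem _ fun k _ =>
      Submodule.smul_mem _ _ (Submodule.subset_span (Set.mem_range_self k))
  have hzero : ∀ o, ¬ Corrupted z o → z o = 0 := by
    intro o ho
    have h01 : ∀ a : ZMod 2, a ≠ 1 → a = 0 := by decide
    exact h01 _ fun h => ho (.fail h)
  have hmem : ∀ o, m o = (C.kind o).eval (c o) ((encodedTInputs dT A Q o).map (Source.read s m)) +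
      z o := fun o => C.memory_stages s z c o
  induction h : encodedTStage L dT Q.Edge o using Nat.strong_induction_on generalizing o with
  | _ n ih =>
    subst h
    have ih' : ∀ o', Source.reg o' ∈ encodedTInputs dT A Q o → ¬ Corrupted z o' →
        m o' = nodeSum f o'.node o'.edge.1.2 := fun o' h h' =>
      ih _ (encodedT_feasible dT hT A Q o o' h) o' h' rfl
    rw [hmem, hzero o ho, add_zero]
    cases o with
    | leaf l e =>
      change (Multiset.map (Source.read s m) {Source.input l, Source.const ((A * Q.G) l e.1.2)}).prod
        = nodeSum f (.inr l : Node L dT) e.1.2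
      rw [nodeSum_inr]
      simp [Source.read, hf]
    | add u e =>
      change (Multiset.map (Source.read s m)
        ((children u).val.map fun w => Source.reg (nodeOut e w))).sum =
          nodeSum f (.inl u : Node L dT) e.1.2
      rw [Multiset.map_map, nodeSum_inl, Finset.sum_apply]
      refine Finset.sum_congr rfl fun w hw => ?_
      have hin : Source.reg (nodeOut e w) ∈
          (children u).val.map fun w => Source.reg (L := L) (nodeOut e w) :=
        Multiset.mem_map_of_mem (fun w => Source.reg (nodeOut e w)) hw
      have h := ih' (nodeOut e w) hin fun h => ho (.add hw h)
      cases w <;> exact h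
    | check u e =>
      change (Multiset.map (Source.read s m)
        ((Q.checkNbrs e).val.map fun e' => Source.reg (.add u e'))).sum =
          nodeSum f (.inl u : Node L dT) e.1.2
      rw [Multiset.map_map, ← sum_checkNbrs (hcode _) e]
      exact Finset.sum_congr rfl fun e' he' =>
        ih' (.add u e') (Multiset.mem_map_of_mem _ he') fun h => ho (.check he' h)
    | vote u e =>
      change majority (c (.vote u e)) (Multiset.map (Source.read s m)
        ((Q.varNbrs e).val.map fun e' => Source.reg (.check u e'))) =
          nodeSum f (.inl u : Node L dT) e.1.2
      classical
      apply majority_eq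
      set B := (Q.varNbrs e).filter fun e' => Corrupted z (.check u e') with hB
      -- Fewer than `dv / 2` messages are corrupted, so at least `(dv - 1) / 2 + 1` are correct.
      have hBlt : B.card < dv / 2 := by
        by_contra hge
        obtain ⟨T, hTB, hTc⟩ := Finset.exists_subset_card_eq (not_lt.1 hge)
        refine ho (.vote T (Finset.mem_powersetCard.2
          ⟨hTB.trans (Finset.filter_subset _ _), hTc⟩) fun e' he' => ?_)
        exact (Finset.mem_filter.1 (hTB he')).2
      have hgood : ((Q.varNbrs e).filter fun e' => ¬ Corrupted z (.check u e')).card ≤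
          ((Q.varNbrs e).filter fun e' => nodeSum f (.inl u : Node L dT) e.1.2 =
            m (.check u e')).card := by
        refine Finset.card_le_card fun e' he' => ?_
        obtain ⟨h1, h2⟩ := Finset.mem_filter.1 he'
        refine Finset.mem_filter.2 ⟨h1, ?_⟩
        have h3 := ih' (.check u e') (Multiset.mem_map_of_mem _ h1) h2
        have h4 : e'.1.2 = e.1.2 := (Finset.mem_filter.1 h1).2.1
        rw [h3, ← h4]
        rfl
      have hsum := Finset.card_filter_add_card_filter_not (s := Q.varNbrs e)
        fun e' => Corrupted z (TOp.check u e')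
      rw [card_varNbrs, ← hB] at hsum
      rw [Multiset.map_map, Multiset.card_map, Multiset.count_map]
      change (Q.varNbrs e).card / 2 + 1 ≤ ((Q.varNbrs e).filter fun e' =>
        nodeSum f (.inl u : Node L dT) e.1.2 = m (.check u e')).card
      rw [card_varNbrs]
      refine le_trans ?_ hgood
      omega

/-- As `G` is systematic, the codeword at the root starts with `s A`. -/
theorem nodeSum_root_systematic (hL : 2 ≤ L) (hT : 2 ≤ dT)
    (A : Matrix (Fin L) (Fin K) (ZMod 2)) (Q : LDPC N K dv dc) (s : Fin L → ZMod 2) (k : Fin K) :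
    nodeSum (fun l => s l • (A * Q.G) l) (.inl ⟨0, numInternal_pos hL hT⟩ : Node L dT)
      (Fin.castLE Q.dim_le k) = Matrix.vecMul s A k := by
  rw [nodeSum_root _ hL hT, Finset.sum_apply]
  have h : ∀ l, (s l • (A * Q.G) l) (Fin.castLE Q.dim_le k) = s l * A l k := by
    intro l
    rw [Pi.smul_apply, smul_eq_mul, Matrix.mul_apply]
    simp [Q.systematic]
  simp only [h]
  rfl

end Correctness

/-! ### The error probability of a scheme -/

section Law

open MeasureTheory ProbabilityTheory

variable {L K : ℕ}

instance (C : Scheme L K) : MeasurableSingletonClass C.Op := ⟨fun _ => trivial⟩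

/-- An output bit is wrong with probability at most `b` if, for each register it may be read from,
the failure patterns `z` that can make the register wrong, whatever the input and the tie-breaking
bits are, have probability at most `b`. -/
theorem Scheme.measureReal_wrong_le (C : Scheme L K) {ε : GateKind → ℝ} (h0 : ∀ g, 0 ≤ ε g)
    (h1 : ∀ g, ε g ≤ 1) (A : Matrix (Fin L) (Fin K) (ZMod 2)) (k : Fin K)
    {W : (C.Op → ZMod 2) → C.Op → Prop} {b : ℝ}
    (hW : ∀ s z c, ∀ o ∈ C.output k, C.memory s z c C.stages o ≠ Matrix.vecMul s A k → W z o)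
    (hb : ∀ o ∈ C.output k, (Measure.pi fun o => bitLaw (ε (C.kind o))).real {z | W z o} ≤ b) :
    (C.law ε).real {ω | C.result ω k ≠ Matrix.vecMul ω.1 A k} ≤ b := by
  have hz : ∀ o, IsProbabilityMeasure (bitLaw (ε (C.kind o))) := fun o =>
    isProbabilityMeasure_bitLaw (h0 _) (h1 _)
  have hc : IsProbabilityMeasure (bitLaw (1 / 2)) :=
    isProbabilityMeasure_bitLaw (by norm_num) (by norm_num)
  have hs : IsProbabilityMeasure (uniformOn (Set.univ : Set (Fin L → ZMod 2))) :=
    isProbabilityMeasure_uniformOn Set.finite_univ Set.univ_nonempty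
  have ho : ∀ k, IsProbabilityMeasure (uniformOn (C.output k : Set C.Op)) := fun k =>
    isProbabilityMeasure_uniformOn (Finset.finite_toSet _) (C.output_nonempty k)
  -- Splitting by the register `o` that is read turns the event into a union of products; registers
  -- outside `output k` are read with probability `0`, so nothing is required of `z` there.
  have hsub : {ω : C.Sample | C.result ω k ≠ Matrix.vecMul ω.1 A k} ⊆
      ⋃ o ∈ (Finset.univ : Finset C.Op), (Set.univ : Set (Fin L → ZMod 2)) ×ˢ
        ({z | o ∈ C.output k → W z o} ×ˢ ((Set.univ : Set (C.Op → ZMod 2)) ×ˢ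
          (Function.eval k ⁻¹' {o} : Set (Fin K → C.Op)))) := by
    rintro ⟨s, z, c, σ⟩ h
    refine Set.mem_biUnion (Finset.mem_coe.2 (Finset.mem_univ (σ k))) ?_
    exact ⟨trivial, fun hk => hW s z c _ hk h, trivial, rfl⟩
  have hU : ∀ o, (Measure.pi fun k => uniformOn (C.output k : Set C.Op)).real
      (Function.eval k ⁻¹' {o}) = (uniformOn (C.output k : Set C.Op)).real {o} := fun o =>
    (measurePreserving_eval _ k).measureReal_preimage
      (measurableSet_singleton o).nullMeasurableSet
  have hlaw : IsProbabilityMeasure (C.law ε) := by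
    unfold Scheme.law
    infer_instance
  refine (measureReal_mono hsub (measure_ne_top _ _)).trans
    ((measureReal_biUnion_finset_le _ _).trans ?_)
  calc _ ≤ ∑ o, b * (uniformOn (C.output k : Set C.Op)).real {o} := by
        refine Finset.sum_le_sum fun o _ => ?_
        rw [Scheme.law, measureReal_prod_prod, measureReal_prod_prod, measureReal_prod_prod, hU,
          probReal_univ, probReal_univ, one_mul, one_mul]
        by_cases hk : o ∈ C.output k
        · simp only [hk, true_imp_iff]
          exact mul_le_mul_of_nonneg_right (hb o hk) measureReal_nonneg
        · have : (uniformOn (C.output k : Set C.Op)).real {o} = 0 := by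
            rw [measureReal_eq_zero_iff, uniformOn_eq_zero_iff (Finset.finite_toSet _)]
            exact Set.inter_singleton_eq_empty.2 hk
          rw [this, mul_zero, mul_zero]
    _ = b := by
        rw [← Finset.mul_sum, sum_measureReal_singleton, Finset.coe_univ, probReal_univ, mul_one]

theorem Scheme.bitErrorProb_le (C : Scheme L K) (hK : 0 < K) {ε : GateKind → ℝ}
    (A : Matrix (Fin L) (Fin K) (ZMod 2)) {b : ℝ}
    (h : ∀ k, (C.law ε).real {ω | C.result ω k ≠ Matrix.vecMul ω.1 A k} ≤ b) :
    C.bitErrorProb A ε ≤ b := by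
  have hK' : (0 : ℝ) < K := by exact_mod_cast hK
  unfold Scheme.bitErrorProb
  rw [one_div, inv_mul_le_iff₀ hK']
  refine (Finset.sum_le_card_nsmul _ _ _ fun k _ => h k).trans_eq ?_
  simp

end Law

/-! ### The error probability, the fan-in and the number of operations of ENCODED-T -/

section EncodedT

variable {L K N dv dc dT : ℕ}

theorem bitErrorProb_encodedT_le (hL : 2 ≤ L) (hK : 0 < K) (hT : 2 ≤ dT) (hdv : 4 ≤ dv)
    (hdc : 4 ≤ dc) (Q : LDPC N K dv dc) (hg : 4 * lastLevel L dT + 2 < Q.tannerGraph.girth)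
    (A : Matrix (Fin L) (Fin K) (ZMod 2)) {ε : GateKind → ℝ} (h0 : ∀ g, 0 ≤ ε g)
    (hmaj : ε .maj ≤ pThr dv dc dT) (hxor : ε .xor ≤ ((dT : ℝ) + 1) / dc * pThr dv dc dT)
    (hand : ε .and ≤ ((dT : ℝ) + 1) / dT * pThr dv dc dT) :
    (encodedT dT hL hT (by omega : 0 < dv) A Q).bitErrorProb A ε ≤
      ε .maj + pThr dv dc dT * (1 / dT) := by
  have hp := pThr_pos (dv := dv) hdc hT
  have hp1 := pThr_mul_le_one hdv hdc hT
  have hdc' : (4 : ℝ) ≤ dc := by exact_mod_cast hdc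
  have hT' : (2 : ℝ) ≤ dT := by exact_mod_cast hT
  have h1 : ∀ g, ε g ≤ 1 := by
    have hle : ∀ x y : ℝ, x ≤ y * pThr dv dc dT → y ≤ ((dT : ℝ) + 1) * dc → x ≤ 1 :=
      fun x y hx hy => hx.trans ((mul_le_mul_of_nonneg_right hy hp.le).trans hp1)
    rintro (_ | _ | _)
    · exact hle _ _ hand ((div_le_self (by positivity) (by linarith)).trans
        (le_mul_of_one_le_right (by positivity) (by linarith)))
    · exact hle _ _ hxor ((div_le_self (by positivity) (by linarith)).trans
        (le_mul_of_one_le_right (by positivity) (by linarith)))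
    · exact hle _ 1 (by linarith) (by nlinarith)
  set C := encodedT dT hL hT (by omega : 0 < dv) A Q with hC
  have hprob : ∀ o : TOp L (numInternal L dT) Q.Edge,
      MeasureTheory.IsProbabilityMeasure (bitLaw (ε (C.kind o))) := fun o =>
    isProbabilityMeasure_bitLaw (h0 _) (h1 _)
  refine C.bitErrorProb_le hK A fun k =>
    C.measureReal_wrong_le h0 h1 A k (W := fun z o => Corrupted z o) ?_ ?_
  · intro s z c o ho
    contrapose!
    intro hcor
    obtain ⟨e, he, rfl⟩ := Finset.mem_map.1 ho
    have he' : e.1.2 = Fin.castLE Q.dim_le k := (Finset.mem_filter.1 he).2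
    refine (memory_eq_of_not_corrupted hL hT (by omega) A Q s z c _ hcor).trans ?_
    rw [← nodeSum_root_systematic hL hT A Q s k, ← he']
    rfl
  · intro o ho
    obtain ⟨e, -, rfl⟩ := Finset.mem_map.1 ho
    refine (corruptionProb_vote_le (η := fun o => ε (C.kind o)) hdv hdc hT hg (fun _ => h0 _)
      (fun _ _ => hxor) (fun _ _ => hxor) _ (fun w _ e' => ?_) e).trans_eq ?_
    · exact corruptionProb_nodeOut_le (η := fun o => ε (C.kind o)) hdv hdc hT hg (fun _ => h0 _) (fun _ _ => hand)
        (fun _ _ => hxor) (fun _ _ => hxor) (fun _ _ => hmaj) w e'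
    · rw [div_eq_mul_one_div]

theorem fanInLE_encodedT {D : ℕ} (hD : 3 < D) (hL : 2 ≤ L) (hT : 2 ≤ dT) (hTD : dT ≤ D)
    (hdv : 4 ≤ dv) (hdvD : dv ≤ D) (hdcD : dc ≤ D) (Q : LDPC N K dv dc)
    (A : Matrix (Fin L) (Fin K) (ZMod 2)) :
    (encodedT dT hL hT (by omega : 0 < dv) A Q).FanInLE D := by
  intro o
  cases o with
  | leaf l e =>
    change Multiset.card {Source.input l, Source.const _} ≤ D
    rw [Multiset.card_pair]
    omega
  | add u e =>
    change Multiset.card ((children u).val.map fun w => Source.reg (nodeOut e w)) ≤ D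
    rw [Multiset.card_map]
    exact (card_children_le u).trans hTD
  | check u e =>
    change Multiset.card ((Q.checkNbrs e).val.map fun e' => Source.reg (TOp.add u e')) ≤ D
    rw [Multiset.card_map]
    have := card_checkNbrs e
    rw [Finset.card_def] at this
    omega
  | vote u e =>
    change Multiset.card ((Q.varNbrs e).val.map fun e' => Source.reg (TOp.check u e')) + 1 ≤ D
    rw [Multiset.card_map]
    have := card_varNbrs e
    rw [Finset.card_def] at this
    omega

theorem ceil_eq_numInternal (L dT : ℕ) :
    ⌈((L : ℝ) - 1) / ((dT : ℝ) - 1)⌉₊ = numInternal L dT := by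
  have h : ((L : ℝ) - 1) / ((dT : ℝ) - 1) = ((((L : ℚ) - 1) / ((dT : ℚ) - 1) : ℚ) : ℝ) := by
    push_cast
    rfl
  rw [h, numInternal, ← Int.ceil_toNat, ← Int.ceil_toNat, Rat.ceil_cast]

theorem numInternal_le (hL : 2 ≤ L) (hT : 2 ≤ dT) : numInternal L dT ≤ L := by
  have h := mul_numInternal_lt hL hT
  have := Nat.le_mul_of_pos_left (numInternal L dT - 1) (show 0 < dT - 1 by omega)
  omega

theorem opsPerBit_encodedT (hL : 2 ≤ L) (hT : 2 ≤ dT) (hdv : 0 < dv) (Q : LDPC N K dv dc)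
    (A : Matrix (Fin L) (Fin K) (ZMod 2)) :
    (encodedT dT hL hT hdv A Q).opsPerBit =
      3 * (Nat.card Q.Edge : ℝ) / K * numInternal L dT + L * (Nat.card Q.Edge : ℝ) / K := by
  have h : Fintype.card (TOp L (numInternal L dT) Q.Edge) =
      L * Nat.card Q.Edge + 3 * (numInternal L dT * Nat.card Q.Edge) := by
    rw [← Fintype.card_congr (TOp.equiv L (numInternal L dT) Q.Edge), Nat.card_eq_fintype_card]
    simp only [Fintype.card_sum, Fintype.card_prod, Fintype.card_fin]
    ring
  rw [Scheme.opsPerBit, Scheme.opCount_eq]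
  change ((Fintype.card (TOp L (numInternal L dT) Q.Edge) : ℕ) : ℝ) / K = _
  rw [h]
  push_cast
  ring

end EncodedT

/-! ### The girth condition -/

section Girth

variable {L K N dv dc dT : ℕ}

/-- The constant in the girth condition is at most `1` if `dv` and `dc` are at least `4`, so that
the girth exceeds `4 M - 2`, where `M` is the number of levels with non-leaf nodes. -/
theorem lt_girth_of_largeGirth (hL : 2 ≤ L) (hT : 2 ≤ dT) (hdv : 4 ≤ dv) (hdc : 4 ≤ dc)
    (Q : LDPC N K dv dc) (hQ : Q.LargeGirth)
    (hN : (⌈Real.log L / Real.log dT⌉₊ : ℝ) ≤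
      Real.log N / (2 * Real.log (((dv : ℝ) - 1) * ((dc : ℝ) - 1)))) :
    4 * lastLevel L dT + 2 < Q.tannerGraph.girth := by
  have hdv' : (4 : ℝ) ≤ dv := by exact_mod_cast hdv
  have hdc' : (4 : ℝ) ≤ dc := by exact_mod_cast hdc
  have hT' : (2 : ℝ) ≤ dT := by exact_mod_cast hT
  have hL' : (2 : ℝ) ≤ L := by exact_mod_cast hL
  have hM : lastLevel L dT + 1 ≤ ⌈Real.log L / Real.log dT⌉₊ := by
    refine (lastLevel_lt_clog hL hT).trans ((Nat.clog_le_iff_le_pow (by omega)).2 ?_)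
    have h := Nat.le_ceil (Real.log L / Real.log dT)
    rw [div_le_iff₀ (Real.log_pos (by linarith)), ← Real.log_pow,
      Real.log_le_log_iff (by linarith) (by positivity)] at h
    exact_mod_cast h
  have hM' : (lastLevel L dT : ℝ) + 1 ≤ ⌈Real.log L / Real.log dT⌉₊ := by exact_mod_cast hM
  have hlog : 0 < Real.log (((dv : ℝ) - 1) * ((dc : ℝ) - 1)) := Real.log_pos (by nlinarith)
  have hκ : 0 ≤ Real.log (((dc : ℝ) * dv - dc - dv) / (2 * dc)) := by
    refine Real.log_nonneg ?_
    rw [one_le_div (by linarith)]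
    nlinarith
  have hdiv := div_nonneg hκ hlog.le
  have hfour : 2 * Real.log N / Real.log (((dv : ℝ) - 1) * ((dc : ℝ) - 1)) =
      4 * (Real.log N / (2 * Real.log (((dv : ℝ) - 1) * ((dc : ℝ) - 1)))) := by
    field_simp
    ring
  unfold LDPC.LargeGirth at hQ
  rw [hfour] at hQ
  have : (4 * lastLevel L dT + 2 : ℝ) < Q.tannerGraph.girth := by linarith
  exact_mod_cast this

end Girth

end Encoded

end

theorem theorem1 (D : ℕ) (hD : 3 < D) :
    ∃ c₁ c₂ : ℝ, 0 < c₁ ∧ 0 < c₂ ∧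
      ∀ (L K N dv dc dT : ℕ) (hL : 2 ≤ L) (_ : 0 < K) (hT : 2 ≤ dT) (_ : dT ≤ D)
        (hdv : 4 ≤ dv) (_ : dv ≤ D) (_ : 4 ≤ dc) (_ : dc ≤ D)
        (Q : Encoded.LDPC N K dv dc) (_ : Q.LargeGirth)
        (A : Matrix (Fin L) (Fin K) (ZMod 2)) (ε : Encoded.GateKind → ℝ)
        (_ : ∀ g, 0 ≤ ε g)
        (_ : ε .maj ≤ Encoded.pThr dv dc dT)
        (_ : ε .xor ≤ ((dT : ℝ) + 1) / dc * Encoded.pThr dv dc dT)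
        (_ : ε .and ≤ ((dT : ℝ) + 1) / dT * Encoded.pThr dv dc dT)
        (_ : (⌈Real.log L / Real.log dT⌉₊ : ℝ) ≤
          Real.log N / (2 * Real.log (((dv : ℝ) - 1) * ((dc : ℝ) - 1)))),
        let C := Encoded.encodedT dT hL hT (by omega : 0 < dv) A Q
        let E : ℝ := Nat.card Q.Edge
        C.FanInLE D ∧
        C.bitErrorProb A ε ≤ ε .maj + Encoded.pThr dv dc dT * (1 / dT) ∧
        C.opsPerBit ≤ 3 * E / K * ⌈((L : ℝ) - 1) / ((dT : ℝ) - 1)⌉₊ + L * E / K ∧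
        c₁ * (L * N / K) ≤ C.opsPerBit ∧
        3 * E / K * ⌈((L : ℝ) - 1) / ((dT : ℝ) - 1)⌉₊ + L * E / K ≤ c₂ * (L * N / K) := by
  -- The number of edges is `dv * N` with `1 ≤ dv ≤ D`, and there are at most `L` non-leaf nodes.
  refine ⟨1, 4 * D, one_pos, by positivity, ?_⟩
  intro L K N dv dc dT hL hK hT hTD hdv hdvD hdc hdcD Q hQ A ε h0 hmaj hxor hand hN C E
  have hops : C.opsPerBit = 3 * E / K * Encoded.numInternal L dT + L * E / K :=
    Encoded.opsPerBit_encodedT hL hT _ Q A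
  have hE : E = dv * N := by
    have : Nat.card Q.Edge = dv * N := Nat.card_eq_fintype_card.trans Encoded.card_edge
    exact (congrArg (Nat.cast (R := ℝ)) this).trans (Nat.cast_mul _ _)
  have hdv1 : (1 : ℝ) ≤ dv := by exact_mod_cast (by omega : 1 ≤ dv)
  have hdvD' : (dv : ℝ) ≤ D := by exact_mod_cast hdvD
  have hS : (Encoded.numInternal L dT : ℝ) ≤ L := by exact_mod_cast Encoded.numInternal_le hL hT
  rw [Encoded.ceil_eq_numInternal]
  refine ⟨Encoded.fanInLE_encodedT hD hL hT hTD hdv hdvD hdcD Q A,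
    Encoded.bitErrorProb_encodedT_le hL hK hT hdv hdc Q
      (Encoded.lt_girth_of_largeGirth hL hT hdv hdc Q hQ hN) A h0 hmaj hxor hand,
    hops.le, ?_, ?_⟩
  · rw [hops, hE, one_mul]
    calc (L * N / K : ℝ) = 1 * (L * N / K) := (one_mul _).symm
      _ ≤ dv * (L * N / K) := by gcongr
      _ = 0 + L * (dv * N) / K := by ring
      _ ≤ _ := by gcongr; positivity
  · rw [hE]
    calc 3 * (dv * N : ℝ) / K * Encoded.numInternal L dT + L * (dv * N) / K
        ≤ 3 * (dv * N : ℝ) / K * L + L * (dv * N) / K := by gcongr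
      _ = 4 * dv * (L * N / K) := by ring
      _ ≤ 4 * D * (L * N / K) := by gcongr
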